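/- Call a square matrix with nonnegative integer entries a magic square of magic sum $s$ if each of its row sums, each of its column sums, and the sums along its two main diagonals are all equal to $s$. For $n\ge 1$ and $s\ge 0$ let $M_n(s)$ be the number of $n\times n$ magic squares of magic sum $s$. Then, as formal power series, $$\sum_{s=0}^{\infty} M_4(s)t^s = \frac{t^8 + 4t^7 + 18t^6 + 36t^5 + 50t^4 + 36t^3 + 18t^2 + 4t + 1}{(1-t)^4(1-t^2)^4} = 1 + 8t + 48t^2 + 200t^3 + 675t^4 + 1904t^5 + 4736t^6 + 10608t^7 + 21925t^8 + \cdots,$$ and, for every integer $s \ge 0$, $$M_4(s) = \begin{cases} \frac{1}{480}s^7 + \frac{7}{240}s^6 + \frac{89}{480}s^5 + \frac{11}{16}s^4 + \frac{49}{30}s^3 + \frac{38}{15}s^2 + \frac{71}{30}s + 1 & \text{if } 2\mid s, \\ \frac{1}{480}s^7 + \frac{7}{240}s^6 + \frac{89}{480}s^5 + \frac{11}{16}s^4 + \frac{779}{480}s^3 + \frac{593}{240}s^2 + \frac{1051}{480}s + \frac{13}{16} & \text{otherwise.} \end{cases}$$ In particular $M_4$ is a quasipolynomial (it agrees with a polynomial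 on each residue class modulo some $N>0$) of degree $7$ (the maximal degree of these polynomials) and of period $2$ (the smallest possible $N$). Moreover $M_5(s) = 1, 20, 449, 6792, 67063, 484419, 2750715$ for $s = 0, 1, 2, 3, 4, 5, 6$ respectively. Finally, for every $n > 2$ the polytope of stochastic magic squares, that is, the set of real nonnegative $n\times n$ matrices all of whose row sums, column sums and two main diagonal sums equal $1$, is not integral: it has a vertex with a non-integer entry. -/

import Mathlib

/-- The square matrix `A` satisfies all the magic sum conditions with value `s`: every row, every
column, the main diagonal and the main antidiagonal add up to `s`. -/
def HasMagicSum {R : Type*} [AddCommMonoid R] {n : ℕ} (A : Matrix (Fin n) (Fin n) R) (s : R) :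
    Prop :=
  (∀ i, ∑ j, A i j = s) ∧ (∀ j, ∑ i, A i j = s) ∧
    ∑ i, A i i = s ∧ ∑ i : Fin n, A i i.rev = s

/-- The set of `n × n` magic squares (nonnegative integer entries) of magic sum `s`. -/
def magicSquares (n s : ℕ) : Set (Matrix (Fin n) (Fin n) ℕ) :=
  {A | HasMagicSum A s}

/-- There are finitely many magic squares of given order and magic sum (each entry is at
most its row sum), so `Set.ncard` below is a genuine cardinality. -/
theorem magicSquares_finite (n s : ℕ) : (magicSquares n s).Finite := by
  have h : (Set.univ.pi fun _ : Fin n => Set.univ.pi fun _ : Fin n => Set.Iic s).Finite :=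
    Set.Finite.pi fun _ => Set.Finite.pi fun _ => Set.finite_Iic s
  refine Set.Finite.subset h ?_
  intro A hA i _ j _
  have := hA.1 i
  rw [Set.mem_Iic, ← this]
  exact Finset.single_le_sum (f := fun j => A i j) (fun _ _ => Nat.zero_le _) (Finset.mem_univ j)

/-- `magicCount n s` is the number `M_n(s)` of `n × n` magic squares of magic sum `s`. -/
noncomputable def magicCount (n s : ℕ) : ℕ :=
  (magicSquares n s).ncard

/-- The polytope of stochastic magic squares: real nonnegative `n × n` matrices all of whose row,
column, main diagonal and main antidiagonal sums are `1`. -/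
def stochasticMagicPolytope (n : ℕ) : Set (Matrix (Fin n) (Fin n) ℝ) :=
  {A | (∀ i j, 0 ≤ A i j) ∧ HasMagicSum A 1}

/-- A polytope in a space of matrices is integral if all entries of all its vertices
(extreme points) are integers. -/
def IsIntegralPolytope {n : ℕ} (P : Set (Matrix (Fin n) (Fin n) ℝ)) : Prop :=
  ∀ A ∈ P.extremePoints ℝ, ∀ i j, ∃ z : ℤ, A i j = z

/-- `f` agrees on each residue class modulo `N > 0` with the polynomial `p i` attached to it. -/
def HasConstituents (f : ℕ → ℂ) (N : ℕ) (p : Fin N → Polynomial ℂ) : Prop :=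
  0 < N ∧ ∀ (m : ℕ) (i : Fin N), m ≡ i [MOD N] → f m = (p i).eval (m : ℂ)

/-- `N` is a quasi-period of `f`; `f` is a quasipolynomial if it has some quasi-period. -/
def IsQuasiPeriod (f : ℕ → ℂ) (N : ℕ) : Prop :=
  ∃ p : Fin N → Polynomial ℂ, HasConstituents f N p

/-- `f` is a quasipolynomial whose period, i.e. smallest quasi-period, is `N`. -/
def IsQuasipolynomialOfPeriod (f : ℕ → ℂ) (N : ℕ) : Prop :=
  IsLeast {k | IsQuasiPeriod f k} N

/-- `f` is a quasipolynomial of degree `d`: the largest degree of its constituents is `d`. -/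
def IsQuasipolynomialOfDegree (f : ℕ → ℂ) (d : ℕ) : Prop :=
  ∃ (N : ℕ) (p : Fin N → Polynomial ℂ), HasConstituents f N p ∧
    (Finset.univ.sup fun i => (p i).degree) = d

/-!
The magic squares of order four form the lattice points of a pointed cone whose monoid is generated
by twenty irreducible squares of magic sum `1` or `2`. The generating function is computed by
induction over the faces of this cone. Every nonzero face contains an irreducible square `g` of sum
`e ∈ {1, 2}` that is dominated entrywise by all squares of the face that are positive on the support
of `g` (`exists_dominated_generator`): for a `0`-`1` square this is clear, and a face without
`0`-`1` irreducible squares is so small that it can be checked. Hence the squares of the face that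
are positive on the support of `g` are the translate by `g` of the whole face, and `1 - X ^ e` times
the generating function of the face is a signed sum of generating functions of faces of smaller
dimension. As the cone has dimension at most eight (`finrank_faceSpan_four`), the generating
function times `(1 - X ^ 2) ^ 8` is a polynomial of degree at most `16`
(`faceSeries_mem_boundedPole`). The same holds for the generating function of the claimed
quasipolynomial, so the two are equal once their first seventeen coefficients agree
(`mk_magicCount_four`).

These coefficients, and the numbers of squares of order five, come from a formula for the number of
`5 × 5` squares whose middle row and column may have a different sum
(`ncard_borderedSquares`). The eight cells of such a square that lie neither on a diagonal nor in
the middle lines form two `2 × 2` tables. A `2 × 2` table is determined by its margins and the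
minimum of its diagonal, and this minimum is any number up to the least margin. Once the
two minima, the centre and the sums of pairs of opposite entries are fixed, the outer and the inner
square can be filled independently, and the count is a short sum of products, which is evaluated.

The quasi-period `1` is impossible because a polynomial that agrees with one constituent at
infinitely many integers equals it, and the constituents have different constant terms.

If the polytope of stochastic magic squares were integral, then by the Krein–Milman theorem every
linear inequality satisfied by the magic squares of sum `1` would hold on it
(`le_of_isIntegralPolytope`). For even `n` the sum of the entries in cells `(i, j)` with `i + j`
odd is an even positive number for a magic square of sum `1`, but equals `1` at some point of the
polytope. For odd `n` the sum of the four corners is at most `1` for a magic square of sum `1`, but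
exceeds `1` at some point.
-/

/-! ### Faces of the cone of magic squares and their Hilbert series -/

/-- The magic squares of sum `s` that vanish at the positions in `Z` and are positive at the
positions in `P`. For `P = ∅` these are the squares in a face of the cone of magic squares. -/
def magicFace {n : ℕ} (Z P : Finset (Fin n × Fin n)) (s : ℕ) : Set (Matrix (Fin n) (Fin n) ℕ) :=
  {A | A ∈ magicSquares n s ∧ (∀ w ∈ Z, A w.1 w.2 = 0) ∧ ∀ w ∈ P, 0 < A w.1 w.2}

theorem magicFace_finite {n : ℕ} (Z P : Finset (Fin n × Fin n)) (s : ℕ) :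
    (magicFace Z P s).Finite :=
  (magicSquares_finite n s).subset fun _ h => h.1

/-- The generating function of the number of squares in `magicFace Z P s`. -/
noncomputable def faceSeries {n : ℕ} (Z P : Finset (Fin n × Fin n)) : PowerSeries ℚ :=
  PowerSeries.mk fun s => ((magicFace Z P s).ncard : ℚ)

theorem faceSeries_insert {n : ℕ} (Z P : Finset (Fin n × Fin n)) (w : Fin n × Fin n) :
    faceSeries Z (insert w P) = faceSeries Z P - faceSeries (insert w Z) P := by
  ext s
  have h1 : magicFace (insert w Z) P s = magicFace Z P s ∩ {A | A w.1 w.2 = 0} := by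
    ext A
    simp only [magicFace, Finset.forall_mem_insert, Set.mem_ofPred_eq, Set.mem_inter_iff]
    tauto
  have h2 : magicFace Z (insert w P) s = magicFace Z P s \ {A | A w.1 w.2 = 0} := by
    ext A
    simp only [magicFace, Finset.forall_mem_insert, Set.mem_ofPred_eq, Set.mem_sdiff,
      Nat.pos_iff_ne_zero]
    tauto
  have h := Set.ncard_inter_add_ncard_sdiff_eq_ncard (magicFace Z P s) {A | A w.1 w.2 = 0}
    (magicFace_finite Z P s)
  rw [← h1, ← h2] at h
  simp only [faceSeries, PowerSeries.coeff_mk, map_sub]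
  rw [← h]
  push_cast
  ring

open PowerSeries in
/-- The power series of the form `p / (1 - X ^ 2) ^ d` with a polynomial `p` of degree at most
`2 * d`. -/
def boundedPole (d : ℕ) : AddSubgroup (PowerSeries ℚ) where
  carrier := {f | ∃ p : Polynomial ℚ, p.natDegree ≤ 2 * d ∧
    f * (1 - X ^ 2) ^ d = (p : PowerSeries ℚ)}
  zero_mem' := ⟨0, by simp, by simp⟩
  add_mem' := by
    rintro f g ⟨p, hp, hf⟩ ⟨q, hq, hg⟩
    exact ⟨p + q, Polynomial.natDegree_add_le_of_degree_le hp hq, by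
      rw [add_mul, hf, hg, Polynomial.coe_add]⟩
  neg_mem' := by
    rintro f ⟨p, hp, hf⟩
    exact ⟨-p, by rwa [Polynomial.natDegree_neg], by rw [neg_mul, hf, Polynomial.coe_neg]⟩

open PowerSeries in
theorem mem_boundedPole {d : ℕ} {f : PowerSeries ℚ} : f ∈ boundedPole d ↔
    ∃ p : Polynomial ℚ, p.natDegree ≤ 2 * d ∧ f * (1 - X ^ 2) ^ d = (p : PowerSeries ℚ) :=
  Iff.rfl

open PowerSeries in
theorem one_mem_boundedPole (d : ℕ) : (1 : PowerSeries ℚ) ∈ boundedPole d := by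
  refine mem_boundedPole.mpr ⟨(1 - Polynomial.X ^ 2) ^ d, ?_, by simp⟩
  refine (Polynomial.natDegree_pow_le).trans ?_
  have : (1 - Polynomial.X ^ 2 : Polynomial ℚ).natDegree ≤ 2 := by compute_degree
  nlinarith

open PowerSeries in
/-- Dividing by `1 - X` or by `1 - X ^ 2` raises the order of the pole by at most one and
keeps the bound on the degree of the numerator. -/
theorem mem_boundedPole_succ {d e : ℕ} (he : e = 1 ∨ e = 2) {f : PowerSeries ℚ}
    (h : (1 - X ^ e) * f ∈ boundedPole d) : f ∈ boundedPole (d + 1) := by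
  obtain ⟨p, hp, hf⟩ := mem_boundedPole.mp h
  rcases he with rfl | rfl
  · refine mem_boundedPole.mpr ⟨p * (1 + Polynomial.X), ?_, ?_⟩
    · have h1 : (1 + Polynomial.X : Polynomial ℚ).natDegree ≤ 1 := by compute_degree
      have := Polynomial.natDegree_mul_le (p := p) (q := (1 + Polynomial.X : Polynomial ℚ))
      omega
    · rw [Polynomial.coe_mul, ← hf]
      simp only [Polynomial.coe_add, Polynomial.coe_one, Polynomial.coe_X]
      ring
  · refine mem_boundedPole.mpr ⟨p, by omega, ?_⟩
    rw [← hf]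
    ring

/-- The span of the magic squares vanishing on `Z`; its dimension is one more than the dimension
of the corresponding face of the polytope of stochastic magic squares. -/
def faceSpan {n : ℕ} (Z : Finset (Fin n × Fin n)) : Submodule ℚ (Matrix (Fin n) (Fin n) ℚ) :=
  Submodule.span ℚ {B | ∃ s, ∃ A ∈ magicFace Z ∅ s, B = A.map (Nat.cast : ℕ → ℚ)}

theorem faceSpan_lt {n s : ℕ} {Z Z' : Finset (Fin n × Fin n)} (hZ : Z ⊆ Z') {w : Fin n × Fin n}
    (hw : w ∈ Z') {g : Matrix (Fin n) (Fin n) ℕ} (hg : g ∈ magicFace Z ∅ s)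
    (hgw : 0 < g w.1 w.2) : faceSpan Z' < faceSpan Z := by
  refine lt_of_le_of_ne (Submodule.span_mono ?_) ?_
  · rintro B ⟨t, A, hA, rfl⟩
    exact ⟨t, A, ⟨hA.1, fun v hv => hA.2.1 v (hZ hv), by simp⟩, rfl⟩
  · intro h
    have hmem : g.map (Nat.cast : ℕ → ℚ) ∈ faceSpan Z' := by
      rw [h]
      exact Submodule.subset_span ⟨s, g, hg, rfl⟩
    have hle : faceSpan Z' ≤ LinearMap.ker (Matrix.entryLinearMap ℚ ℚ w.1 w.2) := by
      refine Submodule.span_le.mpr ?_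
      rintro B ⟨t, A, hA, rfl⟩
      simp [hA.2.1 w hw]
    have := hle hmem
    simp at this
    omega

theorem magicFace_add {n s t : ℕ} {Z P Q : Finset (Fin n × Fin n)}
    {A B : Matrix (Fin n) (Fin n) ℕ} (hA : A ∈ magicFace Z P s) (hB : B ∈ magicFace Z Q t) :
    A + B ∈ magicFace Z (P ∪ Q) (s + t) := by
  obtain ⟨⟨h1, h2, h3, h4⟩, h5, h6⟩ := hA
  obtain ⟨⟨k1, k2, k3, k4⟩, k5, k6⟩ := hB
  refine ⟨⟨fun i => ?_, fun j => ?_, ?_, ?_⟩, fun w hw => ?_, fun w hw => ?_⟩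
  · simp [Finset.sum_add_distrib, h1, k1]
  · simp [Finset.sum_add_distrib, h2, k2]
  · simp [Finset.sum_add_distrib, h3, k3]
  · simp [Finset.sum_add_distrib, h4, k4]
  · simp [h5 w hw, k5 w hw]
  · rcases Finset.mem_union.mp hw with h | h
    · have := h6 w h; simp; omega
    · have := k6 w h; simp; omega

/-- The positions of the positive entries of `g`. -/
def posSupport {n : ℕ} (g : Matrix (Fin n) (Fin n) ℕ) : Finset (Fin n × Fin n) :=
  Finset.univ.filter fun w => 0 < g w.1 w.2

theorem sub_mem_magicFace {n e s : ℕ} {Z P : Finset (Fin n × Fin n)}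
    {g B : Matrix (Fin n) (Fin n) ℕ} (hg : g ∈ magicFace Z ∅ e) (hB : B ∈ magicFace Z P s)
    (hle : ∀ i j, g i j ≤ B i j) : B - g ∈ magicFace Z ∅ (s - e) := by
  obtain ⟨⟨h1, h2, h3, h4⟩, h5, h6⟩ := hg
  obtain ⟨⟨k1, k2, k3, k4⟩, k5, k6⟩ := hB
  refine ⟨⟨fun i => ?_, fun j => ?_, ?_, ?_⟩, fun w hw => ?_, by simp⟩
  · simp only [Matrix.sub_apply]
    rw [Finset.sum_tsub_distrib _ fun j _ => hle i j, h1, k1]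
  · simp only [Matrix.sub_apply]
    rw [Finset.sum_tsub_distrib _ fun i _ => hle i j, h2, k2]
  · simp only [Matrix.sub_apply]
    rw [Finset.sum_tsub_distrib _ fun i _ => hle i i, h3, k3]
  · simp only [Matrix.sub_apply]
    rw [Finset.sum_tsub_distrib _ fun i _ => hle i i.rev, h4, k4]
  · simp [h5 w hw, k5 w hw]

open PowerSeries in
/-- If every square of a face that is positive on the support of `g` dominates `g`, then these
squares are the translates by `g` of the squares of the face. -/
theorem faceSeries_posSupport {n e : ℕ} (hn : 0 < n) {Z : Finset (Fin n × Fin n)}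
    {g : Matrix (Fin n) (Fin n) ℕ} (hg : g ∈ magicFace Z ∅ e)
    (hdom : ∀ s, ∀ B ∈ magicFace Z (posSupport g) s, ∀ i j, g i j ≤ B i j) :
    faceSeries Z (posSupport g) = X ^ e * faceSeries Z ∅ := by
  have hgP : g ∈ magicFace Z (posSupport g) e :=
    ⟨hg.1, hg.2.1, fun w hw => (Finset.mem_filter.mp hw).2⟩
  ext s
  rw [PowerSeries.coeff_X_pow_mul']
  split_ifs with hs
  · have himg : magicFace Z (posSupport g) s = (· + g) '' magicFace Z ∅ (s - e) := by
      ext B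
      constructor
      · intro hB
        have hle := hdom s B hB
        exact ⟨B - g, sub_mem_magicFace hg hB hle, by
          ext i j; exact Nat.sub_add_cancel (hle i j)⟩
      · rintro ⟨A, hA, rfl⟩
        have := magicFace_add hA hgP
        rwa [Finset.empty_union, Nat.sub_add_cancel hs] at this
    simp only [faceSeries, PowerSeries.coeff_mk]
    rw [himg, Set.ncard_image_of_injective _ (add_left_injective g)]
  · have hempty : magicFace Z (posSupport g) s = ∅ := by
      refine Set.eq_empty_of_forall_notMem fun B hB => hs ?_
      rw [← hg.1.1 ⟨0, hn⟩, ← hB.1.1 ⟨0, hn⟩]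
      exact Finset.sum_le_sum fun j _ => hdom s B hB _ j
    simp [faceSeries, hempty]

theorem eq_zero_of_mem_magicSquares_zero {n : ℕ} {A : Matrix (Fin n) (Fin n) ℕ}
    (h : A ∈ magicSquares n 0) : A = 0 := by
  ext i j
  have := h.1 i
  rw [Finset.sum_eq_zero_iff] at this
  exact this j (Finset.mem_univ j)

theorem zero_mem_magicFace {n : ℕ} (Z : Finset (Fin n × Fin n)) : 0 ∈ magicFace Z ∅ 0 := by
  refine ⟨⟨?_, ?_, ?_, ?_⟩, ?_, ?_⟩ <;> simp

theorem faceSeries_eq_one {n : ℕ} {Z : Finset (Fin n × Fin n)}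
    (h : ∀ s, 0 < s → magicFace Z ∅ s = ∅) : faceSeries Z ∅ = 1 := by
  ext s
  rcases Nat.eq_zero_or_pos s with rfl | hs
  · have : magicFace Z ∅ 0 = {0} :=
      Set.Subset.antisymm (fun A hA => eq_zero_of_mem_magicSquares_zero hA.1)
        (by simpa using zero_mem_magicFace Z)
    simp [faceSeries, this]
  · simp [faceSeries, h s hs, PowerSeries.coeff_one, hs.ne']

/-- The Hilbert series of a face of dimension `d` is a polynomial of degree at most `2 * d` divided
by `(1 - X ^ 2) ^ d`, provided that each nonzero face has an element `g` of sum `1` or `2` that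
is dominated by all squares of the face that are positive on the support of `g`. The face minus its
translate by `g` is then a signed sum of proper subfaces. -/
theorem faceSeries_mem_boundedPole {n : ℕ} (hn : 0 < n)
    (H : ∀ (Z : Finset (Fin n × Fin n)) (s : ℕ), 0 < s → (magicFace Z ∅ s).Nonempty →
      ∃ e, (e = 1 ∨ e = 2) ∧ ∃ g ∈ magicFace Z ∅ e,
        ∀ t, ∀ B ∈ magicFace Z (posSupport g) t, ∀ i j, g i j ≤ B i j)
    (d : ℕ) : ∀ Z : Finset (Fin n × Fin n), Module.finrank ℚ (faceSpan Z) ≤ d →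
      faceSeries Z ∅ ∈ boundedPole d := by
  induction d with
  | zero =>
    intro Z hZ
    have hbot : faceSpan Z = ⊥ := Submodule.finrank_eq_zero.mp (Nat.le_zero.mp hZ)
    rw [faceSeries_eq_one]
    · exact one_mem_boundedPole 0
    · intro s hs
      refine Set.eq_empty_of_forall_notMem fun A hA => ?_
      have hmem : A.map (Nat.cast : ℕ → ℚ) ∈ faceSpan Z := Submodule.subset_span ⟨s, A, hA, rfl⟩
      rw [hbot, Submodule.mem_bot] at hmem
      have h0 : ∑ j, A ⟨0, hn⟩ j = 0 := Finset.sum_eq_zero fun j _ => by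
        have := congrFun (congrFun hmem ⟨0, hn⟩) j
        simpa using this
      rw [hA.1.1] at h0
      omega
  | succ d ih =>
    intro Z hZ
    by_cases hne : ∃ s, 0 < s ∧ (magicFace Z ∅ s).Nonempty
    · obtain ⟨s, hs, hA⟩ := hne
      obtain ⟨e, he, g, hg, hdom⟩ := H Z s hs hA
      -- subfaces on which a cell of the support of `g` vanishes do not contain `g`
      have hlow : ∀ P Z' : Finset (Fin n × Fin n), Z ⊆ Z' → (∃ w ∈ Z', 0 < g w.1 w.2) →
          faceSeries Z' P ∈ boundedPole d := by
        intro P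
        induction P using Finset.induction_on with
        | empty =>
          rintro Z' hZ' ⟨w, hw, hgw⟩
          refine ih Z' ?_
          have := Submodule.finrank_lt_finrank_of_lt (faceSpan_lt hZ' hw hg hgw)
          omega
        | insert v P _ ihP =>
          rintro Z' hZ' ⟨w, hw, hgw⟩
          rw [faceSeries_insert]
          exact sub_mem (ihP Z' hZ' ⟨w, hw, hgw⟩)
            (ihP _ (hZ'.trans (Finset.subset_insert _ _)) ⟨w, Finset.mem_insert_of_mem hw, hgw⟩)
      have hdiff : ∀ P : Finset (Fin n × Fin n), P ⊆ posSupport g →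
          faceSeries Z ∅ - faceSeries Z P ∈ boundedPole d := by
        intro P
        induction P using Finset.induction_on with
        | empty => intro _; rw [sub_self]; exact zero_mem _
        | insert v P _ ihP =>
          intro hP
          rw [faceSeries_insert, sub_sub_eq_add_sub, add_sub_right_comm]
          have hv := Finset.mem_filter.mp (hP (Finset.mem_insert_self v P))
          exact add_mem (ihP ((Finset.subset_insert _ _).trans hP))
            (hlow P _ (Finset.subset_insert _ _) ⟨v, Finset.mem_insert_self _ _, hv.2⟩)
      refine mem_boundedPole_succ he ?_
      have := hdiff _ subset_rfl
      rwa [faceSeries_posSupport hn hg hdom, ← one_sub_mul] at this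
    · push Not at hne
      rw [faceSeries_eq_one fun s hs => hne s hs]
      exact one_mem_boundedPole _

/-! ### Irreducible magic squares of order four -/

/-- The irreducible `4 × 4` magic squares with entries `0` and `1`: eight of sum `1` and four of
sum `2`. -/
def binaryIrreducibles : List (Matrix (Fin 4) (Fin 4) ℕ) :=
  [!![0, 0, 0, 1; 0, 1, 0, 0; 1, 0, 0, 0; 0, 0, 1, 0],
    !![0, 0, 0, 1; 1, 0, 0, 0; 0, 0, 1, 0; 0, 1, 0, 0],
    !![0, 0, 1, 0; 0, 1, 0, 0; 0, 0, 0, 1; 1, 0, 0, 0],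
    !![0, 0, 1, 0; 1, 0, 0, 0; 0, 1, 0, 0; 0, 0, 0, 1],
    !![0, 1, 0, 0; 0, 0, 0, 1; 0, 0, 1, 0; 1, 0, 0, 0],
    !![0, 1, 0, 0; 0, 0, 1, 0; 1, 0, 0, 0; 0, 0, 0, 1],
    !![1, 0, 0, 0; 0, 0, 0, 1; 0, 1, 0, 0; 0, 0, 1, 0],
    !![1, 0, 0, 0; 0, 0, 1, 0; 0, 0, 0, 1; 0, 1, 0, 0],
    !![0, 0, 1, 1; 0, 1, 0, 1; 1, 0, 1, 0; 1, 1, 0, 0],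
    !![0, 1, 0, 1; 1, 1, 0, 0; 0, 0, 1, 1; 1, 0, 1, 0],
    !![1, 0, 1, 0; 0, 0, 1, 1; 1, 1, 0, 0; 0, 1, 0, 1],
    !![1, 1, 0, 0; 1, 0, 1, 0; 0, 1, 0, 1; 0, 0, 1, 1]]

/-- The irreducible `4 × 4` magic squares with an entry `2`, all of sum `2`. -/
def otherIrreducibles : List (Matrix (Fin 4) (Fin 4) ℕ) :=
  [!![0, 0, 1, 1; 0, 1, 1, 0; 2, 0, 0, 0; 0, 1, 0, 1],
    !![0, 0, 2, 0; 0, 1, 0, 1; 1, 1, 0, 0; 1, 0, 0, 1],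
    !![0, 1, 0, 1; 2, 0, 0, 0; 0, 1, 1, 0; 0, 0, 1, 1],
    !![0, 2, 0, 0; 1, 0, 1, 0; 0, 0, 1, 1; 1, 0, 0, 1],
    !![1, 0, 0, 1; 0, 0, 1, 1; 1, 0, 1, 0; 0, 2, 0, 0],
    !![1, 0, 0, 1; 1, 1, 0, 0; 0, 1, 0, 1; 0, 0, 2, 0],
    !![1, 0, 1, 0; 0, 0, 0, 2; 0, 1, 1, 0; 1, 1, 0, 0],
    !![1, 1, 0, 0; 0, 1, 1, 0; 0, 0, 0, 2; 1, 0, 1, 0]]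

set_option maxHeartbeats 2000000 in
/-- A `4 × 4` magic square that dominates no irreducible square with entries `0` and `1` vanishes
on one of eight sets of positions: it lies in a face spanned by two of the other irreducible
squares. The entries are named `a` to `p` in reading order. -/
theorem zero_pattern_of_entries (a b c d e f g h i j k l m n o p : ℕ)
    (h1 : d + m = f + k) (h2 : a + p = g + j) (h3 : b + c = m + p) (h4 : n + o = a + d)
    (h5 : e + i = d + p) (h6 : h + l = a + m) (h7 : b + n = g + k)
    (h8 : e + h = j + k)
    (g1 : ¬ ∀ x ∈ [d, f, i, o], 0 < x)
    (g2 : ¬ ∀ x ∈ [d, e, k, n], 0 < x)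
    (g3 : ¬ ∀ x ∈ [c, f, l, m], 0 < x)
    (g4 : ¬ ∀ x ∈ [c, e, j, p], 0 < x)
    (g5 : ¬ ∀ x ∈ [b, h, k, m], 0 < x)
    (g6 : ¬ ∀ x ∈ [b, g, i, p], 0 < x)
    (g7 : ¬ ∀ x ∈ [a, h, j, o], 0 < x)
    (g8 : ¬ ∀ x ∈ [a, g, l, n], 0 < x)
    (g9 : ¬ ∀ x ∈ [c, d, f, h, i, k, m, n], 0 < x)
    (g10 : ¬ ∀ x ∈ [b, d, e, f, k, l, m, o], 0 < x)
    (g11 : ¬ ∀ x ∈ [a, c, g, h, i, j, n, p], 0 < x)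
    (g12 : ¬ ∀ x ∈ [a, b, e, g, j, l, o, p], 0 < x) :
      a + b + e + k + l + o = 0 ∨
      b + e + j + l + m + o = 0 ∨
      b + d + e + g + l + o = 0 ∨
      a + c + f + h + i + n = 0 ∨
      c + g + h + i + m + n = 0 ∨
      c + d + h + i + j + n = 0 ∨
      b + e + f + l + o + p = 0 ∨
      c + h + i + k + n + p = 0 := by
  -- split on the vanishing of entries until the equations are contradictory, one of the eight
  -- patterns is reached or the support of some binary irreducible square is positive
  rcases Nat.eq_zero_or_pos a with rfl | za
  · rcases Nat.eq_zero_or_pos f with rfl | zf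
    · rcases Nat.eq_zero_or_pos e with rfl | ze
      · rcases Nat.eq_zero_or_pos b with rfl | zb
        · left; omega
        · rcases Nat.eq_zero_or_pos g with rfl | zg
          · rcases Nat.eq_zero_or_pos k with rfl | zk
            · exfalso; omega
            · rcases Nat.eq_zero_or_pos m with rfl | zm
              · exfalso; omega
              · rcases Nat.eq_zero_or_pos h with rfl | zh
                · exfalso; omega
                · exact (g5 (by simp [*])).elim
          · rcases Nat.eq_zero_or_pos i with rfl | zi
            · exfalso; omega
            · rcases Nat.eq_zero_or_pos p with rfl | zp
              · exfalso; omega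
              · exact (g6 (by simp [*])).elim
      · rcases Nat.eq_zero_or_pos c with rfl | zc
        · rcases Nat.eq_zero_or_pos k with rfl | zk
          · exfalso; omega
          · rcases Nat.eq_zero_or_pos n with rfl | zn
            · rcases Nat.eq_zero_or_pos b with rfl | zb
              · exfalso; omega
              · rcases Nat.eq_zero_or_pos h with rfl | zh
                · rcases Nat.eq_zero_or_pos i with rfl | zi
                  · right; right; right; left; omega
                  · rcases Nat.eq_zero_or_pos g with rfl | zg
                    · exfalso; omega
                    · rcases Nat.eq_zero_or_pos p with rfl | zp
                      · exfalso; omega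
                      · exact (g6 (by simp [*])).elim
                · rcases Nat.eq_zero_or_pos m with rfl | zm
                  · exfalso; omega
                  · exact (g5 (by simp [*])).elim
            · rcases Nat.eq_zero_or_pos d with rfl | zd
              · exfalso; omega
              · exact (g2 (by simp [*])).elim
        · rcases Nat.eq_zero_or_pos p with rfl | zp
          · exfalso; omega
          · rcases Nat.eq_zero_or_pos j with rfl | zj
            · exfalso; omega
            · exact (g4 (by simp [*])).elim
    · rcases Nat.eq_zero_or_pos c with rfl | zc
      · rcases Nat.eq_zero_or_pos d with rfl | zd
        · exfalso; omega
        · rcases Nat.eq_zero_or_pos o with rfl | zo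
          · exfalso; omega
          · rcases Nat.eq_zero_or_pos i with rfl | zi
            · rcases Nat.eq_zero_or_pos k with rfl | zk
              · exfalso; omega
              · rcases Nat.eq_zero_or_pos e with rfl | ze
                · exfalso; omega
                · rcases Nat.eq_zero_or_pos n with rfl | zn
                  · rcases Nat.eq_zero_or_pos b with rfl | zb
                    · exfalso; omega
                    · rcases Nat.eq_zero_or_pos m with rfl | zm
                      · exfalso; omega
                      · rcases Nat.eq_zero_or_pos l with rfl | zl
                        · exfalso; omega
                        · exact (g10 (by simp [*])).elim
                  · exact (g2 (by simp [*])).elim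
            · exact (g1 (by simp [*])).elim
      · rcases Nat.eq_zero_or_pos l with rfl | zl
        · rcases Nat.eq_zero_or_pos i with rfl | zi
          · exfalso; omega
          · rcases Nat.eq_zero_or_pos o with rfl | zo
            · rcases Nat.eq_zero_or_pos b with rfl | zb
              · rcases Nat.eq_zero_or_pos e with rfl | ze
                · rcases Nat.eq_zero_or_pos d with rfl | zd
                  · left; omega
                  · rcases Nat.eq_zero_or_pos k with rfl | zk
                    · left; omega
                    · rcases Nat.eq_zero_or_pos m with rfl | zm
                      · exfalso; omega
                      · rcases Nat.eq_zero_or_pos n with rfl | zn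
                        · exfalso; omega
                        · rcases Nat.eq_zero_or_pos h with rfl | zh
                          · exfalso; omega
                          · exact (g9 (by simp [*])).elim
                · rcases Nat.eq_zero_or_pos j with rfl | zj
                  · rcases Nat.eq_zero_or_pos k with rfl | zk
                    · exfalso; omega
                    · rcases Nat.eq_zero_or_pos d with rfl | zd
                      · exfalso; omega
                      · rcases Nat.eq_zero_or_pos n with rfl | zn
                        · exfalso; omega
                        · exact (g2 (by simp [*])).elim
                  · rcases Nat.eq_zero_or_pos p with rfl | zp
                    · exfalso; omega
                    · exact (g4 (by simp [*])).elim
              · rcases Nat.eq_zero_or_pos g with rfl | zg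
                · rcases Nat.eq_zero_or_pos k with rfl | zk
                  · exfalso; omega
                  · rcases Nat.eq_zero_or_pos m with rfl | zm
                    · exfalso; omega
                    · rcases Nat.eq_zero_or_pos h with rfl | zh
                      · exfalso; omega
                      · exact (g5 (by simp [*])).elim
                · rcases Nat.eq_zero_or_pos p with rfl | zp
                  · exfalso; omega
                  · exact (g6 (by simp [*])).elim
            · rcases Nat.eq_zero_or_pos d with rfl | zd
              · exfalso; omega
              · exact (g1 (by simp [*])).elim
        · rcases Nat.eq_zero_or_pos m with rfl | zm
          · exfalso; omega
          · exact (g3 (by simp [*])).elim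
  · rcases Nat.eq_zero_or_pos h with rfl | zh
    · rcases Nat.eq_zero_or_pos l with rfl | zl
      · exfalso; omega
      · rcases Nat.eq_zero_or_pos g with rfl | zg
        · rcases Nat.eq_zero_or_pos f with rfl | zf
          · exfalso; omega
          · rcases Nat.eq_zero_or_pos c with rfl | zc
            · rcases Nat.eq_zero_or_pos d with rfl | zd
              · exfalso; omega
              · rcases Nat.eq_zero_or_pos o with rfl | zo
                · exfalso; omega
                · rcases Nat.eq_zero_or_pos i with rfl | zi
                  · rcases Nat.eq_zero_or_pos k with rfl | zk
                    · right; right; right; right; left; omega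
                    · rcases Nat.eq_zero_or_pos e with rfl | ze
                      · exfalso; omega
                      · rcases Nat.eq_zero_or_pos n with rfl | zn
                        · rcases Nat.eq_zero_or_pos b with rfl | zb
                          · exfalso; omega
                          · rcases Nat.eq_zero_or_pos m with rfl | zm
                            · right; right; right; right; left; omega
                            · exact (g10 (by simp [*])).elim
                        · exact (g2 (by simp [*])).elim
                  · exact (g1 (by simp [*])).elim
            · rcases Nat.eq_zero_or_pos m with rfl | zm
              · rcases Nat.eq_zero_or_pos e with rfl | ze
                · exfalso; omega
                · rcases Nat.eq_zero_or_pos j with rfl | zj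
                  · exfalso; omega
                  · rcases Nat.eq_zero_or_pos p with rfl | zp
                    · exfalso; omega
                    · exact (g4 (by simp [*])).elim
              · exact (g3 (by simp [*])).elim
        · rcases Nat.eq_zero_or_pos n with rfl | zn
          · rcases Nat.eq_zero_or_pos b with rfl | zb
            · exfalso; omega
            · rcases Nat.eq_zero_or_pos p with rfl | zp
              · rcases Nat.eq_zero_or_pos f with rfl | zf
                · exfalso; omega
                · rcases Nat.eq_zero_or_pos m with rfl | zm
                  · exfalso; omega
                  · rcases Nat.eq_zero_or_pos c with rfl | zc
                    · rcases Nat.eq_zero_or_pos d with rfl | zd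
                      · right; right; right; right; right; left; omega
                      · rcases Nat.eq_zero_or_pos o with rfl | zo
                        · exfalso; omega
                        · rcases Nat.eq_zero_or_pos i with rfl | zi
                          · rcases Nat.eq_zero_or_pos k with rfl | zk
                            · right; right; right; right; right; right; right; omega
                            · rcases Nat.eq_zero_or_pos e with rfl | ze
                              · exfalso; omega
                              · exact (g10 (by simp [*])).elim
                          · exact (g1 (by simp [*])).elim
                    · exact (g3 (by simp [*])).elim
              · rcases Nat.eq_zero_or_pos i with rfl | zi
                · rcases Nat.eq_zero_or_pos e with rfl | ze
                  · exfalso; omega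
                  · rcases Nat.eq_zero_or_pos o with rfl | zo
                    · exfalso; omega
                    · rcases Nat.eq_zero_or_pos j with rfl | zj
                      · rcases Nat.eq_zero_or_pos m with rfl | zm
                        · exfalso; omega
                        · rcases Nat.eq_zero_or_pos f with rfl | zf
                          · exfalso; omega
                          · rcases Nat.eq_zero_or_pos c with rfl | zc
                            · rcases Nat.eq_zero_or_pos k with rfl | zk
                              · exfalso; omega
                              · rcases Nat.eq_zero_or_pos d with rfl | zd
                                · right; right; right; right; right; left; omega
                                · exact (g10 (by simp [*])).elim
                            · exact (g3 (by simp [*])).elim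
                      · exact (g12 (by simp [*])).elim
                · exact (g6 (by simp [*])).elim
          · exact (g8 (by simp [*])).elim
    · rcases Nat.eq_zero_or_pos j with rfl | zj
      · rcases Nat.eq_zero_or_pos k with rfl | zk
        · exfalso; omega
        · rcases Nat.eq_zero_or_pos b with rfl | zb
          · rcases Nat.eq_zero_or_pos d with rfl | zd
            · exfalso; omega
            · rcases Nat.eq_zero_or_pos n with rfl | zn
              · exfalso; omega
              · rcases Nat.eq_zero_or_pos e with rfl | ze
                · rcases Nat.eq_zero_or_pos l with rfl | zl
                  · rcases Nat.eq_zero_or_pos i with rfl | zi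
                    · exfalso; omega
                    · rcases Nat.eq_zero_or_pos f with rfl | zf
                      · right; left; omega
                      · rcases Nat.eq_zero_or_pos o with rfl | zo
                        · rcases Nat.eq_zero_or_pos c with rfl | zc
                          · exfalso; omega
                          · rcases Nat.eq_zero_or_pos m with rfl | zm
                            · right; left; omega
                            · exact (g9 (by simp [*])).elim
                        · exact (g1 (by simp [*])).elim
                  · rcases Nat.eq_zero_or_pos g with rfl | zg
                    · exfalso; omega
                    · exact (g8 (by simp [*])).elim
                · exact (g2 (by simp [*])).elim
          · rcases Nat.eq_zero_or_pos m with rfl | zm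
            · rcases Nat.eq_zero_or_pos g with rfl | zg
              · exfalso; omega
              · rcases Nat.eq_zero_or_pos i with rfl | zi
                · exfalso; omega
                · rcases Nat.eq_zero_or_pos p with rfl | zp
                  · exfalso; omega
                  · exact (g6 (by simp [*])).elim
            · exact (g5 (by simp [*])).elim
      · rcases Nat.eq_zero_or_pos o with rfl | zo
        · rcases Nat.eq_zero_or_pos c with rfl | zc
          · exfalso; omega
          · rcases Nat.eq_zero_or_pos e with rfl | ze
            · rcases Nat.eq_zero_or_pos n with rfl | zn
              · exfalso; omega
              · rcases Nat.eq_zero_or_pos g with rfl | zg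
                · rcases Nat.eq_zero_or_pos m with rfl | zm
                  · exfalso; omega
                  · rcases Nat.eq_zero_or_pos k with rfl | zk
                    · exfalso; omega
                    · rcases Nat.eq_zero_or_pos b with rfl | zb
                      · rcases Nat.eq_zero_or_pos f with rfl | zf
                        · right; right; left; omega
                        · rcases Nat.eq_zero_or_pos l with rfl | zl
                          · rcases Nat.eq_zero_or_pos i with rfl | zi
                            · exfalso; omega
                            · rcases Nat.eq_zero_or_pos d with rfl | zd
                              · right; right; left; omega
                              · exact (g9 (by simp [*])).elim
                          · exact (g3 (by simp [*])).elim
                      · exact (g5 (by simp [*])).elim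
                · rcases Nat.eq_zero_or_pos l with rfl | zl
                  · rcases Nat.eq_zero_or_pos i with rfl | zi
                    · exfalso; omega
                    · rcases Nat.eq_zero_or_pos p with rfl | zp
                      · rcases Nat.eq_zero_or_pos k with rfl | zk
                        · exfalso; omega
                        · rcases Nat.eq_zero_or_pos m with rfl | zm
                          · exfalso; omega
                          · rcases Nat.eq_zero_or_pos b with rfl | zb
                            · rcases Nat.eq_zero_or_pos d with rfl | zd
                              · exfalso; omega
                              · rcases Nat.eq_zero_or_pos f with rfl | zf
                                · right; right; right; right; right; right; left; omega
                                · exact (g9 (by simp [*])).elim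
                            · exact (g5 (by simp [*])).elim
                      · exact (g11 (by simp [*])).elim
                  · exact (g8 (by simp [*])).elim
            · rcases Nat.eq_zero_or_pos p with rfl | zp
              · rcases Nat.eq_zero_or_pos k with rfl | zk
                · exfalso; omega
                · rcases Nat.eq_zero_or_pos n with rfl | zn
                  · exfalso; omega
                  · rcases Nat.eq_zero_or_pos d with rfl | zd
                    · exfalso; omega
                    · exact (g2 (by simp [*])).elim
              · exact (g4 (by simp [*])).elim
        · exact (g7 (by simp [*])).elim

set_option maxHeartbeats 1000000 in
/-- In the eight faces of `zero_pattern_of_entries`, a square that is positive where one of the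
irreducible squares with an entry `2` is positive also dominates it at that entry. -/
theorem two_le_of_zero_pattern (a b c d e f g h i j k l m n o p : ℕ)
    (h1 : d + m = f + k) (h2 : a + p = g + j) (h3 : b + c = m + p) (h4 : n + o = a + d)
    (h5 : e + i = d + p) (h6 : h + l = a + m) (h7 : b + n = g + k)
    (h8 : e + h = j + k)
    (hz : a + b + e + k + l + o = 0 ∨
      b + e + j + l + m + o = 0 ∨
      b + d + e + g + l + o = 0 ∨
      a + c + f + h + i + n = 0 ∨
      c + g + h + i + m + n = 0 ∨
      c + d + h + i + j + n = 0 ∨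
      b + e + f + l + o + p = 0 ∨
      c + h + i + k + n + p = 0) :
      (0 < c → 0 < d → 0 < f → 0 < g → 0 < i → 0 < n → 0 < p → 2 ≤ i) ∧
      (0 < c → 0 < f → 0 < h → 0 < i → 0 < j → 0 < m → 0 < p → 2 ≤ c) ∧
      (0 < b → 0 < d → 0 < e → 0 < j → 0 < k → 0 < o → 0 < p → 2 ≤ e) ∧
      (0 < b → 0 < e → 0 < g → 0 < k → 0 < l → 0 < m → 0 < p → 2 ≤ b) ∧
      (0 < a → 0 < d → 0 < g → 0 < h → 0 < i → 0 < k → 0 < n → 2 ≤ n) ∧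
      (0 < a → 0 < d → 0 < e → 0 < f → 0 < j → 0 < l → 0 < o → 2 ≤ o) ∧
      (0 < a → 0 < c → 0 < h → 0 < j → 0 < k → 0 < m → 0 < n → 2 ≤ h) ∧
      (0 < a → 0 < b → 0 < f → 0 < g → 0 < l → 0 < m → 0 < o → 2 ≤ l) := by
  simp only [Nat.add_eq_zero_iff] at hz
  rcases hz with hz | hz | hz | hz | hz | hz | hz | hz <;>
    obtain ⟨⟨⟨⟨⟨rfl, rfl⟩, rfl⟩, rfl⟩, rfl⟩, rfl⟩ := hz <;>
    refine ⟨?_, ?_, ?_, ?_, ?_, ?_, ?_, ?_⟩ <;> intros <;> omega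

set_option maxHeartbeats 1000000 in
/-- In the eight faces of `zero_pattern_of_entries`, a nonzero square is positive on the support of
one of the irreducible squares with an entry `2`. -/
theorem exists_pos_of_zero_pattern (a b c d e f g h i j k l m n o p : ℕ) (hs : 0 < a + d + m + p)
    (h1 : d + m = f + k) (h2 : a + p = g + j) (h3 : b + c = m + p) (h4 : n + o = a + d)
    (h5 : e + i = d + p) (h6 : h + l = a + m) (h7 : b + n = g + k)
    (h8 : e + h = j + k)
    (hz : a + b + e + k + l + o = 0 ∨
      b + e + j + l + m + o = 0 ∨
      b + d + e + g + l + o = 0 ∨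
      a + c + f + h + i + n = 0 ∨
      c + g + h + i + m + n = 0 ∨
      c + d + h + i + j + n = 0 ∨
      b + e + f + l + o + p = 0 ∨
      c + h + i + k + n + p = 0) :
      (0 < c ∧ 0 < d ∧ 0 < f ∧ 0 < g ∧ 0 < i ∧ 0 < n ∧ 0 < p) ∨
      (0 < c ∧ 0 < f ∧ 0 < h ∧ 0 < i ∧ 0 < j ∧ 0 < m ∧ 0 < p) ∨
      (0 < b ∧ 0 < d ∧ 0 < e ∧ 0 < j ∧ 0 < k ∧ 0 < o ∧ 0 < p) ∨
      (0 < b ∧ 0 < e ∧ 0 < g ∧ 0 < k ∧ 0 < l ∧ 0 < m ∧ 0 < p) ∨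
      (0 < a ∧ 0 < d ∧ 0 < g ∧ 0 < h ∧ 0 < i ∧ 0 < k ∧ 0 < n) ∨
      (0 < a ∧ 0 < d ∧ 0 < e ∧ 0 < f ∧ 0 < j ∧ 0 < l ∧ 0 < o) ∨
      (0 < a ∧ 0 < c ∧ 0 < h ∧ 0 < j ∧ 0 < k ∧ 0 < m ∧ 0 < n) ∨
      (0 < a ∧ 0 < b ∧ 0 < f ∧ 0 < g ∧ 0 < l ∧ 0 < m ∧ 0 < o) := by
  simp only [Nat.add_eq_zero_iff] at hz
  rcases hz with hz | hz | hz | hz | hz | hz | hz | hz <;>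
    obtain ⟨⟨⟨⟨⟨rfl, rfl⟩, rfl⟩, rfl⟩, rfl⟩, rfl⟩ := hz
  · rcases Nat.eq_zero_or_pos d with rfl | h0
    · right; left; refine ⟨?_, ?_, ?_, ?_, ?_, ?_, ?_⟩ <;> omega
    · left; refine ⟨?_, ?_, ?_, ?_, ?_, ?_, ?_⟩ <;> omega
  · rcases Nat.eq_zero_or_pos c with rfl | h0
    · right; right; right; right; left; refine ⟨?_, ?_, ?_, ?_, ?_, ?_, ?_⟩ <;> omega
    · left; refine ⟨?_, ?_, ?_, ?_, ?_, ?_, ?_⟩ <;> omega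
  · rcases Nat.eq_zero_or_pos f with rfl | h0
    · right; right; right; right; right; right; left; refine ⟨?_, ?_, ?_, ?_, ?_, ?_, ?_⟩ <;> omega
    · right; left; refine ⟨?_, ?_, ?_, ?_, ?_, ?_, ?_⟩ <;> omega
  · rcases Nat.eq_zero_or_pos d with rfl | h0
    · right; right; right; left; refine ⟨?_, ?_, ?_, ?_, ?_, ?_, ?_⟩ <;> omega
    · right; right; left; refine ⟨?_, ?_, ?_, ?_, ?_, ?_, ?_⟩ <;> omega
  · rcases Nat.eq_zero_or_pos b with rfl | h0
    · right; right; right; right; right; left; refine ⟨?_, ?_, ?_, ?_, ?_, ?_, ?_⟩ <;> omega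
    · right; right; left; refine ⟨?_, ?_, ?_, ?_, ?_, ?_, ?_⟩ <;> omega
  · rcases Nat.eq_zero_or_pos e with rfl | h0
    · right; right; right; right; right; right; right; refine ⟨?_, ?_, ?_, ?_, ?_, ?_, ?_⟩ <;> omega
    · right; right; right; left; refine ⟨?_, ?_, ?_, ?_, ?_, ?_, ?_⟩ <;> omega
  · rcases Nat.eq_zero_or_pos d with rfl | h0
    · right; right; right; right; right; right; left; refine ⟨?_, ?_, ?_, ?_, ?_, ?_, ?_⟩ <;> omega
    · right; right; right; right; left; refine ⟨?_, ?_, ?_, ?_, ?_, ?_, ?_⟩ <;> omega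
  · rcases Nat.eq_zero_or_pos d with rfl | h0
    · right; right; right; right; right; right; right; refine ⟨?_, ?_, ?_, ?_, ?_, ?_, ?_⟩ <;> omega
    · right; right; right; right; right; left; refine ⟨?_, ?_, ?_, ?_, ?_, ?_, ?_⟩ <;> omega

theorem magic_four_equations {A : Matrix (Fin 4) (Fin 4) ℕ} {s : ℕ} (h : A ∈ magicSquares 4 s) :
    (A 0 0 + A 0 1 + A 0 2 + A 0 3 = s ∧ A 1 0 + A 1 1 + A 1 2 + A 1 3 = s ∧
      A 2 0 + A 2 1 + A 2 2 + A 2 3 = s ∧ A 3 0 + A 3 1 + A 3 2 + A 3 3 = s) ∧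
    (A 0 0 + A 1 0 + A 2 0 + A 3 0 = s ∧ A 0 1 + A 1 1 + A 2 1 + A 3 1 = s ∧
      A 0 2 + A 1 2 + A 2 2 + A 3 2 = s ∧ A 0 3 + A 1 3 + A 2 3 + A 3 3 = s) ∧
    A 0 0 + A 1 1 + A 2 2 + A 3 3 = s ∧ A 0 3 + A 1 2 + A 2 1 + A 3 0 = s := by
  obtain ⟨h1, h2, h3, h4⟩ := h
  simp only [Fin.sum_univ_four] at h1 h2 h3 h4
  exact ⟨⟨h1 0, h1 1, h1 2, h1 3⟩, ⟨h2 0, h2 1, h2 2, h2 3⟩, h3, h4⟩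

instance {n : ℕ} (A : Matrix (Fin n) (Fin n) ℕ) (s : ℕ) : Decidable (HasMagicSum A s) :=
  inferInstanceAs (Decidable (_ ∧ _))

theorem forall_fin_four {q : Fin 4 → Fin 4 → Prop} : (∀ i j, q i j) ↔
    (q 0 0 ∧ q 0 1 ∧ q 0 2 ∧ q 0 3) ∧ (q 1 0 ∧ q 1 1 ∧ q 1 2 ∧ q 1 3) ∧
      (q 2 0 ∧ q 2 1 ∧ q 2 2 ∧ q 2 3) ∧ q 3 0 ∧ q 3 1 ∧ q 3 2 ∧ q 3 3 := by
  simp [Fin.forall_fin_succ]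

theorem binaryIrreducibles_spec : ∀ g ∈ binaryIrreducibles,
    (∃ e, (e = 1 ∨ e = 2) ∧ g ∈ magicSquares 4 e) ∧ ∀ i j, g i j ≤ 1 := by
  have h : ∀ g ∈ binaryIrreducibles,
      HasMagicSum g 1 ∨ HasMagicSum g 2 := by decide +kernel
  have h' : ∀ g ∈ binaryIrreducibles, ∀ i j, g i j ≤ 1 := by
    simp [binaryIrreducibles, forall_fin_four]
  intro g hg
  refine ⟨?_, h' g hg⟩
  rcases h g hg with h | h
  · exact ⟨1, Or.inl rfl, h⟩
  · exact ⟨2, Or.inr rfl, h⟩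

theorem otherIrreducibles_spec : ∀ g ∈ otherIrreducibles, g ∈ magicSquares 4 2 := by
  have h : ∀ g ∈ otherIrreducibles, HasMagicSum g 2 := by
    decide +kernel
  exact h

/-- A `4 × 4` magic square that dominates no irreducible square with entries `0` and `1`
dominates each of the other irreducible squares on whose support it is positive, and if it is
nonzero, there is such a square. -/
theorem dominates_otherIrreducibles {A : Matrix (Fin 4) (Fin 4) ℕ} {s : ℕ}
    (hA : A ∈ magicSquares 4 s)
    (hbin : ∀ g ∈ binaryIrreducibles, ¬ ∀ i j, 0 < g i j → 0 < A i j) :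
    (∀ g ∈ otherIrreducibles, (∀ i j, 0 < g i j → 0 < A i j) → ∀ i j, g i j ≤ A i j) ∧
      (0 < s → ∃ g ∈ otherIrreducibles, ∀ i j, 0 < g i j → 0 < A i j) := by
  obtain ⟨⟨r1, r2, r3, r4⟩, ⟨c1, c2, c3, c4⟩, d1, d2⟩ := magic_four_equations hA
  have h1 : A 0 3 + A 3 0 = A 1 1 + A 2 2 := by omega
  have h2 : A 0 0 + A 3 3 = A 1 2 + A 2 1 := by omega
  have h3 : A 0 1 + A 0 2 = A 3 0 + A 3 3 := by omega
  have h4 : A 3 1 + A 3 2 = A 0 0 + A 0 3 := by omega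
  have h5 : A 1 0 + A 2 0 = A 0 3 + A 3 3 := by omega
  have h6 : A 1 3 + A 2 3 = A 0 0 + A 3 0 := by omega
  have h7 : A 0 1 + A 3 1 = A 1 2 + A 2 2 := by omega
  have h8 : A 1 0 + A 1 3 = A 2 1 + A 2 2 := by omega
  have h9 : A 0 0 + A 0 3 + A 3 0 + A 3 3 = s := by omega
  simp [binaryIrreducibles, forall_fin_four] at hbin
  obtain ⟨g1, g2, g3, g4, g5, g6, g7, g8, g9, g10, g11, g12⟩ := hbin
  have hz := zero_pattern_of_entries (A 0 0) (A 0 1) (A 0 2) (A 0 3) (A 1 0) (A 1 1) (A 1 2)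
    (A 1 3) (A 2 0) (A 2 1) (A 2 2) (A 2 3) (A 3 0) (A 3 1) (A 3 2) (A 3 3)
    h1 h2 h3 h4 h5 h6 h7 h8 (by simpa using g1) (by simpa using g2) (by simpa using g3)
    (by simpa using g4) (by simpa using g5) (by simpa using g6) (by simpa using g7)
    (by simpa using g8) (by simpa using g9) (by simpa using g10) (by simpa using g11)
    (by simpa using g12)
  clear g1 g2 g3 g4 g5 g6 g7 g8 g9 g10 g11 g12
  constructor
  · obtain ⟨t1, t2, t3, t4, t5, t6, t7, t8⟩ :=
      two_le_of_zero_pattern _ _ _ _ _ _ _ _ _ _ _ _ _ _ _ _ h1 h2 h3 h4 h5 h6 h7 h8 hz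
    simp [otherIrreducibles, forall_fin_four, Nat.one_le_iff_ne_zero]
    refine ⟨?_, ?_, ?_, ?_, ?_, ?_, ?_, ?_⟩ <;> intro p1 p2 p3 p4 p5 p6 p7
    · simp [p1.ne', p2.ne', p3.ne', p4.ne', p6.ne', p7.ne', t1 p1 p2 p3 p4 p5 p6 p7]
    · simp [p2.ne', p3.ne', p4.ne', p5.ne', p6.ne', p7.ne', t2 p1 p2 p3 p4 p5 p6 p7]
    · simp [p1.ne', p2.ne', p4.ne', p5.ne', p6.ne', p7.ne', t3 p1 p2 p3 p4 p5 p6 p7]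
    · simp [p2.ne', p3.ne', p4.ne', p5.ne', p6.ne', p7.ne', t4 p1 p2 p3 p4 p5 p6 p7]
    · simp [p1.ne', p2.ne', p3.ne', p4.ne', p5.ne', p6.ne', t5 p1 p2 p3 p4 p5 p6 p7]
    · simp [p1.ne', p2.ne', p3.ne', p4.ne', p5.ne', p6.ne', t6 p1 p2 p3 p4 p5 p6 p7]
    · simp [p1.ne', p2.ne', p4.ne', p5.ne', p6.ne', p7.ne', t7 p1 p2 p3 p4 p5 p6 p7]
    · simp [p1.ne', p2.ne', p3.ne', p4.ne', p6.ne', p7.ne', t8 p1 p2 p3 p4 p5 p6 p7]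
  · intro hs
    have hpos := exists_pos_of_zero_pattern _ _ _ _ _ _ _ _ _ _ _ _ _ _ _ _ (hs.trans_eq h9.symm) h1
      h2 h3 h4 h5 h6 h7 h8 hz
    simp only [otherIrreducibles, List.exists_mem_cons_iff]
    refine hpos.imp ?_ (.imp ?_ (.imp ?_ (.imp ?_ (.imp ?_ (.imp ?_ (.imp ?_ fun h => .inl ?_))))))
    case refine_8 =>
      obtain ⟨p1, p2, p3, p4, p5, p6, p7⟩ := h
      rw [forall_fin_four]
      simp [p1, p2, p3, p4, p5, p6, p7]
    all_goals
      rintro ⟨p1, p2, p3, p4, p5, p6, p7⟩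
      rw [forall_fin_four]
      simp [p1, p2, p3, p4, p5, p6, p7]

/-- Each nonzero face of the cone of `4 × 4` magic squares contains a square `g` of sum `1` or `2`
that is dominated by all squares of the face which are positive on its support. -/
theorem exists_dominated_generator (Z : Finset (Fin 4 × Fin 4)) (s : ℕ) (hs : 0 < s)
    (hne : (magicFace Z ∅ s).Nonempty) :
    ∃ e, (e = 1 ∨ e = 2) ∧ ∃ g ∈ magicFace Z ∅ e,
      ∀ t, ∀ B ∈ magicFace Z (posSupport g) t, ∀ i j, g i j ≤ B i j := by
  have hsupp : ∀ {g B : Matrix (Fin 4) (Fin 4) ℕ} {t : ℕ}, B ∈ magicFace Z (posSupport g) t →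
      ∀ i j, 0 < g i j → 0 < B i j := fun hB i j h =>
    hB.2.2 (i, j) (Finset.mem_filter.mpr ⟨Finset.mem_univ _, h⟩)
  have hface : ∀ {g B : Matrix (Fin 4) (Fin 4) ℕ}, (∀ w ∈ Z, B w.1 w.2 = 0) →
      (∀ i j, 0 < g i j → 0 < B i j) → ∀ w ∈ Z, g w.1 w.2 = 0 := fun hB h w hw =>
    Nat.eq_zero_of_not_pos fun hg => (h _ _ hg).ne' (hB w hw)
  by_cases hbin : ∃ g ∈ binaryIrreducibles, ∀ w ∈ Z, g w.1 w.2 = 0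
  · obtain ⟨g, hg, hgZ⟩ := hbin
    obtain ⟨⟨e, he, hge⟩, hle⟩ := binaryIrreducibles_spec g hg
    refine ⟨e, he, g, ⟨hge, hgZ, by simp⟩, fun t B hB i j => ?_⟩
    have h1 := hle i j
    have h2 := hsupp hB i j
    omega
  · push Not at hbin
    have hbin' : ∀ {B : Matrix (Fin 4) (Fin 4) ℕ}, (∀ w ∈ Z, B w.1 w.2 = 0) →
        ∀ g ∈ binaryIrreducibles, ¬ ∀ i j, 0 < g i j → 0 < B i j := fun hB g hg h => by
      obtain ⟨w, hw, hne⟩ := hbin g hg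
      exact hne (hface hB h w hw)
    obtain ⟨A, hA⟩ := hne
    obtain ⟨g, hg, hgA⟩ := (dominates_otherIrreducibles hA.1 (hbin' hA.2.1)).2 hs
    refine ⟨2, Or.inr rfl, g, ⟨otherIrreducibles_spec g hg, hface hA.2.1 hgA, by simp⟩,
      fun t B hB => ?_⟩
    exact (dominates_otherIrreducibles hB.1 (hbin' hB.2.1)).1 g hg (hsupp hB)

/-- The space of `4 × 4` matrices with equal line sums has dimension at most eight: such a matrix is
determined by the eight entries below. -/
theorem finrank_faceSpan_four (Z : Finset (Fin 4 × Fin 4)) :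
    Module.finrank ℚ (faceSpan Z) ≤ 8 := by
  let V : Submodule ℚ (Matrix (Fin 4) (Fin 4) ℚ) :=
    { carrier := {A | ∃ s, HasMagicSum A s}
      zero_mem' := ⟨0, by simp [HasMagicSum]⟩
      add_mem' := by
        rintro A B ⟨s, h1, h2, h3, h4⟩ ⟨t, k1, k2, k3, k4⟩
        exact ⟨s + t, by simp [HasMagicSum, Finset.sum_add_distrib, h1, h2, h3, h4, k1, k2, k3, k4]⟩
      smul_mem' := by
        rintro c A ⟨s, h1, h2, h3, h4⟩
        exact ⟨c * s, by simp [HasMagicSum, ← Finset.mul_sum, h1, h2, h3, h4]⟩ }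
  have hle : faceSpan Z ≤ V := by
    refine Submodule.span_le.mpr ?_
    rintro B ⟨s, A, ⟨⟨h1, h2, h3, h4⟩, -⟩, rfl⟩
    refine ⟨s, fun i => ?_, fun j => ?_, ?_, ?_⟩ <;> simp only [Matrix.map_apply]
    · exact_mod_cast h1 i
    · exact_mod_cast h2 j
    · exact_mod_cast h3
    · exact_mod_cast h4
  let φ : Matrix (Fin 4) (Fin 4) ℚ →ₗ[ℚ] Fin 8 → ℚ :=
    LinearMap.pi ![Matrix.entryLinearMap ℚ ℚ 0 0, Matrix.entryLinearMap ℚ ℚ 0 3,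
      Matrix.entryLinearMap ℚ ℚ 3 0, Matrix.entryLinearMap ℚ ℚ 3 3,
      Matrix.entryLinearMap ℚ ℚ 1 1, Matrix.entryLinearMap ℚ ℚ 1 2,
      Matrix.entryLinearMap ℚ ℚ 0 1, Matrix.entryLinearMap ℚ ℚ 1 0]
  have hinj : Function.Injective (φ.domRestrict V) := by
    rw [← LinearMap.ker_eq_bot, LinearMap.ker_eq_bot']
    rintro ⟨A, s, h1, h2, h3, h4⟩ hA
    have e : ∀ k, φ A k = 0 := fun k => congrFun hA k
    have e0 : A 0 0 = 0 := e 0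
    have e1 : A 0 3 = 0 := e 1
    have e2 : A 3 0 = 0 := e 2
    have e3 : A 3 3 = 0 := e 3
    have e4 : A 1 1 = 0 := e 4
    have e5 : A 1 2 = 0 := e 5
    have e6 : A 0 1 = 0 := e 6
    have e7 : A 1 0 = 0 := e 7
    simp only [Fin.sum_univ_four] at h1 h2 h3 h4
    have h40 : A 0 3 + A 1 2 + A 2 1 + A 3 0 = s := h4
    have r0 := h1 0
    have r1 := h1 1
    have r2 := h1 2
    have r3 := h1 3
    have c0 := h2 0
    have c1 := h2 1
    have c2 := h2 2
    have c3 := h2 3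
    ext i j
    fin_cases i <;> fin_cases j <;> simp <;> linarith
  have h1 := Submodule.finrank_mono hle
  have h2 := LinearMap.finrank_le_finrank_of_injective hinj
  simp only [Module.finrank_fin_fun] at h2
  omega

/-! ### Counting squares of order four and five by blocks -/

/-- The `5 × 5` matrices of natural numbers whose middle row and column have sum `t` and whose
other lines, including both diagonals, have sum `s`. For `t = s` they are the magic squares of
order five; for `t = 0` the middle row and column vanish and what remains is a magic square of order
four. -/
def borderedSquares (s t : ℕ) : Set (Matrix (Fin 5) (Fin 5) ℕ) :=
  {A | (∀ i, ∑ j, A i j = if i = 2 then t else s) ∧ (∀ j, ∑ i, A i j = if j = 2 then t else s) ∧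
    ∑ i, A i i = s ∧ ∑ i : Fin 5, A i i.rev = s}

theorem borderedSquares_self (s : ℕ) : borderedSquares s s = magicSquares 5 s := by
  simp [borderedSquares, magicSquares, HasMagicSum]

theorem mem_borderedSquares {s t : ℕ} {A : Matrix (Fin 5) (Fin 5) ℕ} : A ∈ borderedSquares s t ↔
    (A 0 0 + A 0 1 + A 0 2 + A 0 3 + A 0 4 = s ∧ A 1 0 + A 1 1 + A 1 2 + A 1 3 + A 1 4 = s ∧
      A 2 0 + A 2 1 + A 2 2 + A 2 3 + A 2 4 = t ∧ A 3 0 + A 3 1 + A 3 2 + A 3 3 + A 3 4 = s ∧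
      A 4 0 + A 4 1 + A 4 2 + A 4 3 + A 4 4 = s) ∧
    (A 0 0 + A 1 0 + A 2 0 + A 3 0 + A 4 0 = s ∧ A 0 1 + A 1 1 + A 2 1 + A 3 1 + A 4 1 = s ∧
      A 0 2 + A 1 2 + A 2 2 + A 3 2 + A 4 2 = t ∧ A 0 3 + A 1 3 + A 2 3 + A 3 3 + A 4 3 = s ∧
      A 0 4 + A 1 4 + A 2 4 + A 3 4 + A 4 4 = s) ∧
    A 0 0 + A 1 1 + A 2 2 + A 3 3 + A 4 4 = s ∧ A 0 4 + A 1 3 + A 2 2 + A 3 1 + A 4 0 = s := by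
  have hforall : ∀ q : Fin 5 → Prop, (∀ i, q i) ↔ q 0 ∧ q 1 ∧ q 2 ∧ q 3 ∧ q 4 := fun q => by
    simp [Fin.forall_fin_succ]
  simp only [borderedSquares, Set.mem_ofPred_eq, Fin.sum_univ_five, hforall]
  exact Iff.rfl

theorem magicCount_four_eq (s : ℕ) : magicCount 4 s = (borderedSquares s 0).ncard := by
  refine Set.ncard_congr (fun A _ => !![A 0 0, A 0 1, 0, A 0 2, A 0 3;
    A 1 0, A 1 1, 0, A 1 2, A 1 3; 0, 0, 0, 0, 0; A 2 0, A 2 1, 0, A 2 2, A 2 3; A 3 0, A 3 1, 0, A 3 2, A 3 3]) ?_ ?_ ?_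
  · intro A hA
    obtain ⟨⟨r1, r2, r3, r4⟩, ⟨c1, c2, c3, c4⟩, d1, d2⟩ := magic_four_equations hA
    exact mem_borderedSquares.mpr ⟨⟨r1, r2, rfl, r3, r4⟩, ⟨c1, c2, rfl, c3, c4⟩, d1, d2⟩
  · intro A B _ _ h
    have e : ∀ i j : Fin 5, _ = _ := fun i j => congrFun (congrFun h i) j
    have h1 : ∀ i : Fin 4, A i = B i := fun i => by
      funext j
      fin_cases i <;> fin_cases j
      exacts [e 0 0, e 0 1, e 0 3, e 0 4, e 1 0, e 1 1, e 1 3, e 1 4, e 3 0, e 3 1, e 3 3, e 3 4,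
        e 4 0, e 4 1, e 4 3, e 4 4]
    exact funext h1
  · intro B hB
    obtain ⟨⟨r0, r1, r2, r3, r4⟩, ⟨c0, c1, c2, c3, c4⟩, d1, d2⟩ := mem_borderedSquares.mp hB
    refine ⟨!![B 0 0, B 0 1, B 0 3, B 0 4; B 1 0, B 1 1, B 1 3, B 1 4;
      B 3 0, B 3 1, B 3 3, B 3 4; B 4 0, B 4 1, B 4 3, B 4 4], ⟨?_, ?_, ?_, ?_⟩, ?_⟩
    · intro i
      rw [Fin.sum_univ_four]
      fin_cases i
      exacts [(by omega : B 0 0 + B 0 1 + B 0 3 + B 0 4 = s),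
        (by omega : B 1 0 + B 1 1 + B 1 3 + B 1 4 = s),
        (by omega : B 3 0 + B 3 1 + B 3 3 + B 3 4 = s),
        (by omega : B 4 0 + B 4 1 + B 4 3 + B 4 4 = s)]
    · intro j
      rw [Fin.sum_univ_four]
      fin_cases j
      exacts [(by omega : B 0 0 + B 1 0 + B 3 0 + B 4 0 = s),
        (by omega : B 0 1 + B 1 1 + B 3 1 + B 4 1 = s),
        (by omega : B 0 3 + B 1 3 + B 3 3 + B 4 3 = s),
        (by omega : B 0 4 + B 1 4 + B 3 4 + B 4 4 = s)]
    · rw [Fin.sum_univ_four]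
      exact (by omega : B 0 0 + B 1 1 + B 3 3 + B 4 4 = s)
    · rw [Fin.sum_univ_four]
      exact (by omega : B 0 4 + B 1 3 + B 3 1 + B 4 0 = s)
    · obtain ⟨⟨z1, z2⟩, ⟨z3, z4⟩, ⟨z5, z6⟩, ⟨z7, z8⟩, z9⟩ : (B 0 2 = 0 ∧ B 1 2 = 0) ∧
          (B 3 2 = 0 ∧ B 4 2 = 0) ∧ (B 2 0 = 0 ∧ B 2 1 = 0) ∧ (B 2 3 = 0 ∧ B 2 4 = 0) ∧
            B 2 2 = 0 := by omega
      funext i j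
      fin_cases i <;> fin_cases j
      exacts [rfl, rfl, z1.symm, rfl, rfl, rfl, rfl, z2.symm, rfl, rfl, z5.symm, z6.symm, z9.symm,
        z7.symm, z8.symm, rfl, rfl, z3.symm, rfl, rfl, rfl, rfl, z4.symm, rfl, rfl]

/-- A `2 × 2` table is determined by its margins and the minimum of its diagonal. -/
theorem table_ext {p q r t p' q' r' t' : ℕ} (h1 : p + q = p' + q') (h2 : r + t = r' + t')
    (h3 : p + r = p' + r') (h4 : min p t = min p' t') : p = p' ∧ q = q' ∧ r = r' ∧ t = t' := by
  omega

/-- The minimum of the diagonal of a `2 × 2` table takes all values that do not exceed the four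
margins. -/
theorem exists_table {k R R' C C' : ℕ} (h : R + R' = C + C') (h1 : k ≤ R) (h2 : k ≤ R')
    (h3 : k ≤ C) (h4 : k ≤ C') :
    ∃ p q r t, p + q = R ∧ r + t = R' ∧ p + r = C ∧ q + t = C' ∧ min p t = k := by
  refine ⟨k + (C - R'), R - k - (C - R'), C - k - (C - R'), k + (R' - C), ?_⟩
  omega

/-- The ways to fill the four corners and the four border cells in the middle row and column:
`a`, `b` are the entries in the upper corners, `n` and `m` those in the middle of the first row and
of the first column. The diagonals through the corners contribute `x` and `y`, the middle row and
column contribute `u` and `v`, and the other cells of the border are to be filled with two `2 × 2`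
tables whose margins are at least `k` in the rows and `l` in the columns. -/
def cornerFillings (s k l x y u v : ℕ) : Finset (ℕ × ℕ × ℕ × ℕ) :=
  (Finset.range (x + 1) ×ˢ Finset.range (y + 1) ×ˢ Finset.range (v + 1) ×ˢ
    Finset.range (u + 1)).filter fun c =>
      (c.2.2.1 + c.1 + c.2.1 + k ≤ s ∧ x + y + v + k ≤ s + c.1 + c.2.1 + c.2.2.1) ∧
        c.1 + y + c.2.2.2 + l ≤ s + c.2.1 ∧ c.2.1 + x + u + l ≤ s + c.1 + c.2.2.2

theorem mem_cornerFillings {s k l x y u v a b n m : ℕ} :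
    (a, b, n, m) ∈ cornerFillings s k l x y u v ↔ (a ≤ x ∧ b ≤ y ∧ n ≤ v ∧ m ≤ u) ∧
      (n + a + b + k ≤ s ∧ x + y + v + k ≤ s + a + b + n) ∧
        a + y + m + l ≤ s + b ∧ b + x + u + l ≤ s + a + m := by
  simp [cornerFillings]

/-- The parameters `(z, x, y, u, k, l)` by which bordered squares are classified: the entry in the
centre, the sums of the two pairs of opposite corners, the sum of the outer entries of the middle
row, and the minima of the diagonals of the tables in the rows `0, 4` and columns `1, 3` and in the
rows `1, 3` and columns `0, 4`. The sum `v` of the outer entries of the middle column is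
then `2 * (s - z) + (t - z) - 2 * (x + y) - u`. -/
def squareParameters (s t : ℕ) : Finset (ℕ × ℕ × ℕ × ℕ × ℕ × ℕ) :=
  (Finset.range (t + 1) ×ˢ Finset.range (s + 1) ×ˢ Finset.range (s + 1) ×ˢ Finset.range (t + 1) ×ˢ
    Finset.range (s + 1) ×ˢ Finset.range (s + 1)).filter fun c =>
      (c.1 ≤ s ∧ c.1 + c.2.1 ≤ s ∧ c.1 + c.2.2.1 ≤ s ∧ c.1 + c.2.2.2.1 ≤ t ∧
        2 * (c.2.1 + c.2.2.1) + c.2.2.2.1 + c.1 + 2 * c.1 ≤ 2 * s + t ∧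
        2 * s ≤ 2 * (c.2.1 + c.2.2.1) + c.2.2.2.1 + 2 * c.1)

/-- The pairs of fillings of the outer and of the inner corners for given parameters. -/
def fillings (s t : ℕ) (c : ℕ × ℕ × ℕ × ℕ × ℕ × ℕ) :
    Finset ((ℕ × ℕ × ℕ × ℕ) × (ℕ × ℕ × ℕ × ℕ)) :=
  match c with
  | (z, x, y, u, k, l) =>
    cornerFillings s k l x y u (2 * s + t - 3 * z - 2 * (x + y) - u) ×ˢ
      cornerFillings s l k (s - z - x) (s - z - y) (t - z - u)
        (t - z - (2 * s + t - 3 * z - 2 * (x + y) - u))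

/-- A bordered square is determined by its central entry, half of the entries in the corners of the
outer and of the inner square and in the middle lines, the sums of some opposite entries, and the
minima of the diagonals of two `2 × 2` tables. -/
theorem borderedSquares_ext {s t : ℕ} {A B : Matrix (Fin 5) (Fin 5) ℕ}
    (hA : A ∈ borderedSquares s t) (hB : B ∈ borderedSquares s t)
    (h0 : A 0 0 = B 0 0 ∧ A 0 2 = B 0 2 ∧ A 0 4 = B 0 4 ∧ A 2 0 = B 2 0)
    (h1 : A 1 1 = B 1 1 ∧ A 1 2 = B 1 2 ∧ A 1 3 = B 1 3 ∧ A 2 1 = B 2 1) (e22 : A 2 2 = B 2 2)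
    (hx : A 0 0 + A 4 4 = B 0 0 + B 4 4) (hy : A 0 4 + A 4 0 = B 0 4 + B 4 0)
    (hu : A 2 0 + A 2 4 = B 2 0 + B 2 4) (hk : min (A 0 1) (A 4 3) = min (B 0 1) (B 4 3))
    (hl : min (A 1 0) (A 3 4) = min (B 1 0) (B 3 4)) : A = B := by
  obtain ⟨⟨r0, r1, r2, r3, r4⟩, ⟨c0, c1, c2, c3, c4⟩, d1, d2⟩ := mem_borderedSquares.mp hA
  obtain ⟨⟨r0', r1', r2', r3', r4'⟩, ⟨c0', c1', c2', c3', c4'⟩, d1', d2'⟩ :=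
    mem_borderedSquares.mp hB
  obtain ⟨e00, e02, e04, e20⟩ := h0
  obtain ⟨e11, e12, e13, e21⟩ := h1
  have e44 : A 4 4 = B 4 4 := by simpa [e00] using hx
  have e40 : A 4 0 = B 4 0 := by simpa [e04] using hy
  have e24 : A 2 4 = B 2 4 := by simpa [e20] using hu
  have e33 : A 3 3 = B 3 3 := by simpa [e00, e11, e22, e44] using d1.trans d1'.symm
  have e31 : A 3 1 = B 3 1 := by simpa [e04, e13, e22, e40] using d2.trans d2'.symm
  have e23 : A 2 3 = B 2 3 := by simpa [e20, e21, e22, e24] using r2.trans r2'.symm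
  rw [e00, e02, e04] at r0
  rw [e40, e44] at r4
  rw [e11, e21, e31] at c1
  rw [e13, e23, e33] at c3
  have e42 : A 4 2 = B 4 2 := by
    clear hx hy hu hk hl r1 r1' r2 r2' r3 r3' c0 c0' c2 c2' c4 c4' d1 d1' d2 d2'
    omega
  have e32 : A 3 2 = B 3 2 := by simpa [e02, e12, e22, e42] using c2.trans c2'.symm
  rw [e42] at r4
  rw [e11, e12, e13] at r1
  rw [e31, e32, e33] at r3
  rw [e00, e20, e40] at c0
  clear hx hy hu r2 r2' c2 c2' c4 c4' d1 d1' d2 d2'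
  obtain ⟨e01, e03, e41, e43⟩ := table_ext (p := A 0 1) (q := A 0 3) (r := A 4 1) (t := A 4 3)
    (p' := B 0 1) (q' := B 0 3) (r' := B 4 1) (t' := B 4 3) (by linarith) (by linarith)
    (by linarith) hk
  obtain ⟨e10, e14, e30, e34⟩ := table_ext (p := A 1 0) (q := A 1 4) (r := A 3 0) (t := A 3 4)
    (p' := B 1 0) (q' := B 1 4) (r' := B 3 0) (t' := B 3 4) (by linarith) (by linarith)
    (by linarith) hl
  funext i j
  fin_cases i <;> fin_cases j <;> assumption

theorem mem_cornerFillings_of_le {s k l a b c d n n' m m' : ℕ} (h1 : a + b + n + k ≤ s)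
    (h2 : c + d + n' + k ≤ s) (h3 : a + c + m + l ≤ s) (h4 : b + d + m' + l ≤ s) :
    (a, b, n, m) ∈ cornerFillings s k l (a + d) (b + c) (m + m') (n + n') := by
  rw [mem_cornerFillings]
  omega

theorem le_of_mem_cornerFillings {s k l a b c d n n' m m' : ℕ}
    (h : (a, b, n, m) ∈ cornerFillings s k l (a + d) (b + c) (m + m') (n + n')) :
    (a + b + n + k ≤ s ∧ c + d + n' + k ≤ s) ∧ a + c + m + l ≤ s ∧ b + d + m' + l ≤ s := by
  rw [mem_cornerFillings] at h
  omega

theorem exists_add_of_mem_cornerFillings {s k l x y u v a b n m : ℕ}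
    (h : (a, b, n, m) ∈ cornerFillings s k l x y u v) :
    ∃ d c m' n', x = a + d ∧ y = b + c ∧ u = m + m' ∧ v = n + n' := by
  obtain ⟨ha, hb, hn, hm⟩ := (mem_cornerFillings.mp h).1
  exact ⟨x - a, y - b, u - m, v - n, by omega⟩

theorem sub_sub_outer {a b c d e s : ℕ} (h : a + b + c + d + e = s) :
    s - c - (a + e) = b + d := by
  omega

theorem inner_add_le {a b c d e s k : ℕ} (h : a + b + c + d + e = s) (hk : k ≤ a ∨ k ≤ e) :
    b + d + c + k ≤ s := by
  omega

theorem outer_add_le {a b c d e s k : ℕ} (h : a + b + c + d + e = s) (hk : k ≤ b ∨ k ≤ d) :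
    a + e + c + k ≤ s := by
  omega

/-- The relation that expresses the sum of the outer entries of the middle column by the other
parameters. -/
theorem middle_column_of_mem_borderedSquares {s t : ℕ} {A : Matrix (Fin 5) (Fin 5) ℕ}
    (hA : A ∈ borderedSquares s t) : A 0 2 + A 4 2 + (3 * A 2 2 +
      2 * (A 0 0 + A 4 4 + (A 0 4 + A 4 0)) + (A 2 0 + A 2 4)) = 2 * s + t := by
  obtain ⟨⟨r0, -, r2, -, r4⟩, ⟨-, c1, -, c3, -⟩, d1, d2⟩ := mem_borderedSquares.mp hA
  linarith

theorem outer_sum_eq {a b n p q k R s : ℕ} (h : p + q = k + R) (hs : s = a + b + n + k + R) :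
    a + p + n + q + b = s := by
  omega

theorem inner_sum_eq {a b n p q k R s : ℕ} (h : p + q = k + R) (hs : s = a + b + n + k + R) :
    p + a + n + b + q = s := by
  omega

/-- Entries of the corners and of the middle lines that leave room for `k` and `l` extend to a
bordered square; the remaining eight cells form two `2 × 2` tables. -/
theorem exists_mem_borderedSquares {s t a b c d e f g h m m' m₁ m₂ n n' n₁ n₂ z k l : ℕ}
    (j1 : a + e + z + h + d = s) (j2 : b + f + z + g + c = s) (j3 : m + m' + z + m₂ + m₁ = t)
    (j4 : n + n' + z + n₂ + n₁ = t)
    (j5 : n + n₁ + (3 * z + 2 * (a + d + (b + c)) + (m + m₁)) = 2 * s + t)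
    (i1 : a + b + n + k ≤ s) (i2 : c + d + n₁ + k ≤ s) (i3 : a + c + m + l ≤ s)
    (i4 : b + d + m₁ + l ≤ s) (i5 : e + f + n' + l ≤ s) (i6 : g + h + n₂ + l ≤ s)
    (i7 : e + g + m' + k ≤ s) (i8 : f + h + m₂ + k ≤ s) :
    ∃ p q r w p' q' r' w', min p w = k ∧ min p' w' = l ∧
      !![a, p, n, q, b; p', e, n', f, q'; m, m', z, m₂, m₁; r', g, n₂, h, w';
        c, r, n₁, w, d] ∈ borderedSquares s t := by
  obtain ⟨R, hR⟩ := Nat.exists_eq_add_of_le i1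
  obtain ⟨R', hR'⟩ := Nat.exists_eq_add_of_le i2
  obtain ⟨Q, hQ⟩ := Nat.exists_eq_add_of_le i3
  obtain ⟨Q', hQ'⟩ := Nat.exists_eq_add_of_le i4
  obtain ⟨S, hS⟩ := Nat.exists_eq_add_of_le i5
  obtain ⟨S', hS'⟩ := Nat.exists_eq_add_of_le i6
  obtain ⟨T, hT⟩ := Nat.exists_eq_add_of_le i7
  obtain ⟨T', hT'⟩ := Nat.exists_eq_add_of_le i8
  obtain ⟨p, q, r, w, t1, t2, t3, t4, t5⟩ := exists_table (k := k) (R := k + R) (R' := k + R')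
    (C := k + T) (C' := k + T') (by linarith) (by simp) (by simp) (by simp) (by simp)
  obtain ⟨p', q', r', w', t1', t2', t3', t4', t5'⟩ := exists_table (k := l) (R := l + S)
    (R' := l + S') (C := l + Q) (C' := l + Q') (by linarith) (by simp) (by simp) (by simp)
    (by simp)
  exact ⟨p, q, r, w, p', q', r', w', t5, t5', mem_borderedSquares.mpr
    ⟨⟨outer_sum_eq t1 hR, inner_sum_eq t1' hS, j3, inner_sum_eq t2' hS', outer_sum_eq t2 hR'⟩,
      ⟨outer_sum_eq t3' hQ, inner_sum_eq t3 hT, j4, inner_sum_eq t4 hT', outer_sum_eq t4' hQ'⟩,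
      j1, j2⟩⟩

/-- A bordered square is determined by its parameters and its two corner fillings, and every choice
of them occurs: what is left to fill are two `2 × 2` tables with prescribed margins and
prescribed minimum of the diagonal. -/
theorem ncard_borderedSquares (s t : ℕ) : (borderedSquares s t).ncard =
    ∑ c ∈ squareParameters s t, (fillings s t c).card := by
  rw [← Finset.card_sigma, ← Set.ncard_coe_finset]
  refine Set.ncard_congr (fun A _ => ⟨(A 2 2, A 0 0 + A 4 4, A 0 4 + A 4 0, A 2 0 + A 2 4,
    min (A 0 1) (A 4 3), min (A 1 0) (A 3 4)),
    (A 0 0, A 0 4, A 0 2, A 2 0), (A 1 1, A 1 3, A 1 2, A 2 1)⟩) ?_ ?_ ?_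
  · intro A hA
    have hv := middle_column_of_mem_borderedSquares hA
    have hv' : 2 * s + t - 3 * A 2 2 - 2 * (A 0 0 + A 4 4 + (A 0 4 + A 4 0)) - (A 2 0 + A 2 4) =
        A 0 2 + A 4 2 := by omega
    obtain ⟨⟨r0, r1, r2, r3, r4⟩, ⟨c0, c1, c2, c3, c4⟩, d1, d2⟩ := mem_borderedSquares.mp hA
    obtain ⟨k, hk⟩ : ∃ k, min (A 0 1) (A 4 3) = k := ⟨_, rfl⟩
    obtain ⟨l, hl⟩ : ∃ l, min (A 1 0) (A 3 4) = l := ⟨_, rfl⟩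
    have hk1 : k ≤ A 0 1 := hk ▸ min_le_left _ _
    have hk2 : k ≤ A 4 3 := hk ▸ min_le_right _ _
    have hl1 : l ≤ A 1 0 := hl ▸ min_le_left _ _
    have hl2 : l ≤ A 3 4 := hl ▸ min_le_right _ _
    simp only [Finset.coe_sigma, Set.mem_sigma_iff, Finset.mem_coe, fillings, Finset.mem_product,
      hv', sub_sub_outer d1, sub_sub_outer d2, sub_sub_outer r2, sub_sub_outer c2, hk, hl]
    refine ⟨?_, ?_, ?_⟩
    · simp only [squareParameters, Finset.mem_filter, Finset.mem_product, Finset.mem_range,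
        Nat.lt_succ_iff]
      refine ⟨⟨?_, ?_, ?_, ?_, ?_, ?_⟩, ?_, ?_, ?_, ?_, ?_, ?_⟩ <;> linarith
    · exact mem_cornerFillings_of_le (outer_add_le r0 (.inl hk1)) (outer_add_le r4 (.inr hk2))
        (outer_add_le c0 (.inl hl1)) (outer_add_le c4 (.inr hl2))
    · exact mem_cornerFillings_of_le (inner_add_le r1 (.inl hl1)) (inner_add_le r3 (.inr hl2))
        (inner_add_le c1 (.inl hk1)) (inner_add_le c3 (.inr hk2))
  · intro A B hA hB h
    simp only [Sigma.mk.injEq, heq_eq_eq, Prod.mk.injEq] at h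
    obtain ⟨⟨e22, hx, hy, hu, hk, hl⟩, ⟨e00, e04, e02, e20⟩, e11, e13, e12, e21⟩ := h
    exact borderedSquares_ext hA hB ⟨e00, e02, e04, e20⟩ ⟨e11, e12, e13, e21⟩ e22 hx hy hu hk hl
  · rintro ⟨⟨z, x, y, u, k, l⟩, ⟨a, b, n, m⟩, ⟨e, f, n', m'⟩⟩ hc
    simp only [Finset.coe_sigma, Set.mem_sigma_iff, Finset.mem_coe, fillings,
      Finset.mem_product, squareParameters, Finset.mem_filter, Finset.mem_range] at hc
    obtain ⟨⟨-, hz, hzx, hzy, hzu, hv1, hv2⟩, hc1, hc2⟩ := hc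
    obtain ⟨v, hv⟩ : ∃ v, v = 2 * s + t - 3 * z - 2 * (x + y) - u := ⟨_, rfl⟩
    rw [← hv] at hc1 hc2
    obtain ⟨d, c, m₁, n₁, rfl, rfl, rfl, rfl⟩ := exists_add_of_mem_cornerFillings hc1
    obtain ⟨h, g, m₂, n₂, hh, hg, hm, hn⟩ := exists_add_of_mem_cornerFillings hc2
    rw [hh, hg, hm, hn] at hc2
    obtain ⟨⟨i1, i2⟩, i3, i4⟩ := le_of_mem_cornerFillings hc1
    obtain ⟨⟨i5, i6⟩, i7, i8⟩ := le_of_mem_cornerFillings hc2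
    have hv3 : n + n₁ + z ≤ t := by omega
    have j1 : a + e + z + h + d = s := by omega
    have j2 : b + f + z + g + c = s := by omega
    have j3 : m + m' + z + m₂ + m₁ = t := by omega
    have j4 : n + n' + z + n₂ + n₁ = t := by omega
    have j5 : n + n₁ + (3 * z + 2 * (a + d + (b + c)) + (m + m₁)) = 2 * s + t := by omega
    obtain ⟨p, q, r, w, p', q', r', w', rfl, rfl, hB⟩ :=
      exists_mem_borderedSquares j1 j2 j3 j4 j5 i1 i2 i3 i4 i5 i6 i7 i8
    exact ⟨_, hB, rfl⟩

/-! ### Evaluation of the counts -/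

/-- The sum `f 0 + ⋯ + f n`, by recursion on `n`, in a form that the kernel evaluates fast. -/
def sumTo (n : ℕ) (f : ℕ → ℕ) : ℕ :=
  Nat.rec (f 0) (fun k r => r + f (k + 1)) n

theorem sumTo_eq (n : ℕ) (f : ℕ → ℕ) : sumTo n f = ∑ i ∈ Finset.range (n + 1), f i := by
  induction n with
  | zero => simp [sumTo]
  | succ n ih =>
    rw [Finset.sum_range_succ, ← ih]
    rfl

/-- The number of corner fillings: once `a` and `b` are chosen, `n` and `m` vary independently in
two intervals. -/
def cornerCount (s k l x y u v : ℕ) : ℕ :=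
  sumTo x fun a => sumTo y fun b =>
    (min (v + 1) (s + 1 - (a + b + k)) - (x + y + v + k - (s + a + b))) *
      (min (u + 1) (s + b + 1 - (a + y + l)) - (b + x + u + l - (s + a)))

theorem card_cornerFillings (s k l x y u v : ℕ) :
    (cornerFillings s k l x y u v).card = cornerCount s k l x y u v := by
  simp only [cornerCount, sumTo_eq, cornerFillings, Finset.card_filter, Finset.sum_product]
  refine Finset.sum_congr rfl fun a _ => Finset.sum_congr rfl fun b _ => ?_
  have hn : ∀ n : ℕ, (n < v + 1 ∧ n + a + b + k ≤ s ∧ x + y + v + k ≤ s + a + b + n) ↔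
      n ∈ Finset.Ico (x + y + v + k - (s + a + b)) (min (v + 1) (s + 1 - (a + b + k))) := by
    intro n
    rw [Finset.mem_Ico]
    omega
  have hm : ∀ m : ℕ, (m < u + 1 ∧ a + y + m + l ≤ s + b ∧ b + x + u + l ≤ s + a + m) ↔
      m ∈ Finset.Ico (b + x + u + l - (s + a)) (min (u + 1) (s + b + 1 - (a + y + l))) := by
    intro m
    rw [Finset.mem_Ico]
    omega
  rw [← Nat.card_Ico (x + y + v + k - (s + a + b)), ← Nat.card_Ico (b + x + u + l - (s + a)),
    ← Finset.card_product, ← Finset.sum_product',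
    ← Finset.card_filter]
  congr 1
  ext ⟨n, m⟩
  rw [Finset.mem_product, ← hn, ← hm]
  simp
  tauto

theorem cornerCount_eq_zero {s k l x y u v : ℕ}
    (h : 2 * s < 2 * k + (x + y + v) ∨ 2 * s < 2 * l + (x + y + u)) :
    cornerCount s k l x y u v = 0 := by
  rw [← card_cornerFillings, Finset.card_eq_zero]
  refine Finset.eq_empty_of_forall_notMem fun c hc => ?_
  have := mem_cornerFillings.mp hc
  omega

theorem sum_range_range_eq {K L N : ℕ} (hK : K ≤ N) (hL : L ≤ N) (f : ℕ → ℕ → ℕ)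
    (h : ∀ k l, K < k ∨ L < l → f k l = 0) :
    ∑ k ∈ Finset.range (N + 1), ∑ l ∈ Finset.range (N + 1), f k l =
      ∑ k ∈ Finset.range (K + 1), ∑ l ∈ Finset.range (L + 1), f k l := by
  have hsub : ∀ {M : ℕ}, M ≤ N → Finset.range (M + 1) ⊆ Finset.range (N + 1) := fun hM =>
    Finset.range_subset_range.mpr (by omega)
  refine (Finset.sum_subset (hsub hK) fun k _ hk => Finset.sum_eq_zero fun l _ => h k l
    (Or.inl (by simpa using hk))).symm.trans (Finset.sum_congr rfl fun k _ => ?_)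
  exact (Finset.sum_subset (hsub hL) fun l _ hl => h k l (Or.inr (by simpa using hl))).symm

/-- The number of bordered squares as a nested sum over the parameters. -/
def borderedCount (s t : ℕ) : ℕ :=
  sumTo t fun z => sumTo s fun x => sumTo s fun y => sumTo t fun u =>
    if z ≤ s ∧ z + x ≤ s ∧ z + y ≤ s ∧ z + u ≤ t ∧ 2 * (x + y) + u + z + 2 * z ≤ 2 * s + t ∧
        2 * s ≤ 2 * (x + y) + u + 2 * z then
      sumTo ((2 * s - (x + y + (2 * s + t - 3 * z - 2 * (x + y) - u))) / 2) fun k =>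
        sumTo ((2 * s - (x + y + u)) / 2) fun l =>
          cornerCount s k l x y u (2 * s + t - 3 * z - 2 * (x + y) - u) *
            cornerCount s l k (s - z - x) (s - z - y) (t - z - u)
              (t - z - (2 * s + t - 3 * z - 2 * (x + y) - u))
    else 0

theorem ncard_borderedSquares_eq (s t : ℕ) : (borderedSquares s t).ncard = borderedCount s t := by
  rw [ncard_borderedSquares]
  simp only [borderedCount, sumTo_eq, squareParameters, Finset.sum_filter, Finset.sum_product,
    fillings, Finset.card_product, card_cornerFillings]
  refine Finset.sum_congr rfl fun z _ => Finset.sum_congr rfl fun x _ => Finset.sum_congr rfl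
    fun y _ => Finset.sum_congr rfl fun u _ => ?_
  split_ifs with h
  · refine sum_range_range_eq (by omega) (by omega) _ fun k l hkl => ?_
    rw [cornerCount_eq_zero (by omega), zero_mul]
  · simp

/-- The number of corner fillings when the middle row and column vanish. -/
def cornerCountFour (s k l x y : ℕ) : ℕ :=
  sumTo x fun a =>
    min (y + 1) (min (s + 1 - (a + k)) (s + a + 1 - (x + l))) -
      max (x + y + k - (s + a)) (a + y + l - s)

theorem card_cornerFillings_zero (s k l x y : ℕ) :
    (cornerFillings s k l x y 0 0).card = cornerCountFour s k l x y := by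
  simp only [cornerCountFour, sumTo_eq, cornerFillings, Finset.card_filter, Finset.sum_product,
    zero_add, Finset.sum_range_one]
  refine Finset.sum_congr rfl fun a _ => ?_
  rw [← Nat.card_Ico, ← Finset.card_filter]
  congr 1
  ext b
  simp only [Finset.mem_filter, Finset.mem_range, Finset.mem_Ico]
  omega

/-- Reflecting the inner square turns the conditions on its corners into those on the outer
corners. -/
theorem card_cornerFillings_swap (k l x y : ℕ) :
    (cornerFillings (x + y) l k y x 0 0).card = (cornerFillings (x + y) k l x y 0 0).card := by
  refine Finset.card_bij' (fun c _ => (c.2.1, y - c.1, 0, 0)) (fun c _ => (y - c.2.1, c.1, 0, 0))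
    ?_ ?_ ?_ ?_
  · rintro ⟨a, b, n, m⟩ h
    rw [mem_cornerFillings] at h
    refine mem_cornerFillings.mpr ?_
    dsimp only
    omega
  · rintro ⟨a, b, n, m⟩ h
    rw [mem_cornerFillings] at h
    refine mem_cornerFillings.mpr ?_
    dsimp only
    omega
  · rintro ⟨a, b, n, m⟩ h
    rw [mem_cornerFillings] at h
    obtain ⟨rfl, rfl⟩ : n = 0 ∧ m = 0 := by omega
    simp only [Prod.mk.injEq, and_true]
    omega
  · rintro ⟨a, b, n, m⟩ h
    rw [mem_cornerFillings] at h
    obtain ⟨rfl, rfl⟩ : n = 0 ∧ m = 0 := by omega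
    simp only [Prod.mk.injEq, and_true, true_and]
    omega

/-- The number of `4 × 4` magic squares as a sum of squares. -/
def squareSum (s : ℕ) : ℕ :=
  sumTo s fun x => sumTo (s / 2) fun k => sumTo (s / 2) fun l =>
    cornerCountFour s k l x (s - x) * cornerCountFour s k l x (s - x)

theorem magicCount_four (s : ℕ) : magicCount 4 s = squareSum s := by
  rw [magicCount_four_eq, ncard_borderedSquares_eq]
  simp only [borderedCount, squareSum, sumTo_eq, zero_add, Finset.sum_range_one]
  refine Finset.sum_congr rfl fun x hx => ?_
  have hx : x ≤ s := Nat.lt_succ_iff.mp (Finset.mem_range.mp hx)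
  rw [Finset.sum_eq_single (s - x)]
  · rw [if_pos (by omega)]
    have h1 : 2 * s + 0 - 3 * 0 - 2 * (x + (s - x)) - 0 = 0 := by omega
    have h2 : (2 * s - (x + (s - x) + 0)) / 2 = s / 2 := by omega
    have h3 : s - 0 - x = s - x := by omega
    have h4 : s - 0 - (s - x) = x := by omega
    simp only [h1, h2, h3, h4, ← card_cornerFillings, ← card_cornerFillings_zero]
    refine Finset.sum_congr rfl fun k _ => Finset.sum_congr rfl fun l _ => ?_
    have := card_cornerFillings_swap k l x (s - x)
    rw [Nat.add_sub_cancel' hx] at this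
    rw [Nat.sub_zero, Nat.sub_zero, this]
  · intro y _ hy
    rw [if_neg (by omega)]
  · intro h
    exact absurd (Finset.mem_range.mpr (by omega)) h

theorem magicCount_five (s : ℕ) : magicCount 5 s = borderedCount s s := by
  rw [magicCount, ← borderedSquares_self, ncard_borderedSquares_eq]

theorem magicCount_five_values : (List.range 7).map (magicCount 5) =
    [1, 20, 449, 6792, 67063, 484419, 2750715] := by
  rw [show magicCount 5 = fun s => borderedCount s s from funext magicCount_five]
  decide +kernel

theorem magicCount_four_values : (List.range 17).map (magicCount 4) =
    [1, 8, 48, 200, 675, 1904, 4736, 10608, 21925, 42328, 77328, 134680, 225351, 364000, 570368,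
      869856, 1295433] := by
  rw [show magicCount 4 = squareSum from funext magicCount_four]
  decide +kernel

/-! ### The generating function of the number of 4 × 4 magic squares -/

/-- The quasipolynomial that counts `4 × 4` magic squares of magic sum `s`. -/
def fourQuasipolynomial (s : ℕ) : ℚ :=
  if 2 ∣ s then
    1 / 480 * (s : ℚ) ^ 7 + 7 / 240 * (s : ℚ) ^ 6 + 89 / 480 * (s : ℚ) ^ 5
      + 11 / 16 * (s : ℚ) ^ 4 + 49 / 30 * (s : ℚ) ^ 3 + 38 / 15 * (s : ℚ) ^ 2
      + 71 / 30 * (s : ℚ) + 1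
  else
    1 / 480 * (s : ℚ) ^ 7 + 7 / 240 * (s : ℚ) ^ 6 + 89 / 480 * (s : ℚ) ^ 5
      + 11 / 16 * (s : ℚ) ^ 4 + 779 / 480 * (s : ℚ) ^ 3 + 593 / 240 * (s : ℚ) ^ 2
      + 1051 / 480 * (s : ℚ) + 13 / 16

open Polynomial in
/-- The numerator of the generating function over the denominator `(1 - X ^ 2) ^ 8`. -/
noncomputable def fourNumerator : ℚ[X] :=
  (X ^ 8 + 4 * X ^ 7 + 18 * X ^ 6 + 36 * X ^ 5 + 50 * X ^ 4 + 36 * X ^ 3 + 18 * X ^ 2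
    + 4 * X + 1) * (1 + X) ^ 4

open Polynomial in
theorem natDegree_fourNumerator_le : fourNumerator.natDegree ≤ 16 := by
  unfold fourNumerator
  compute_degree!

open PowerSeries in
theorem coeff_mul_one_sub_X_sq_pow_eight (f : PowerSeries ℚ) (n : ℕ) :
    coeff n (f * (1 - X ^ 2) ^ 8) = coeff n f
      - 8 * (if 2 ≤ n then coeff (n - 2) f else 0) + 28 * (if 4 ≤ n then coeff (n - 4) f else 0)
      - 56 * (if 6 ≤ n then coeff (n - 6) f else 0) + 70 * (if 8 ≤ n then coeff (n - 8) f else 0)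
      - 56 * (if 10 ≤ n then coeff (n - 10) f else 0)
      + 28 * (if 12 ≤ n then coeff (n - 12) f else 0)
      - 8 * (if 14 ≤ n then coeff (n - 14) f else 0)
      + (if 16 ≤ n then coeff (n - 16) f else 0) := by
  have h : f * (1 - X ^ 2) ^ 8 = f - C 8 * (f * X ^ 2) + C 28 * (f * X ^ 4) - C 56 * (f * X ^ 6)
      + C 70 * (f * X ^ 8) - C 56 * (f * X ^ 10) + C 28 * (f * X ^ 12) - C 8 * (f * X ^ 14)
      + f * X ^ 16 := by
    simp only [map_ofNat]
    ring
  rw [h]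
  simp only [map_add, map_sub, coeff_C_mul, coeff_mul_X_pow']

open PowerSeries in
theorem mk_fourQuasipolynomial_mul :
    PowerSeries.mk fourQuasipolynomial * (1 - X ^ 2) ^ 8 = (fourNumerator : PowerSeries ℚ) := by
  have hN : fourNumerator = Polynomial.X ^ 12 + 8 * Polynomial.X ^ 11 + 40 * Polynomial.X ^ 10
      + 136 * Polynomial.X ^ 9 + 319 * Polynomial.X ^ 8 + 528 * Polynomial.X ^ 7
      + 624 * Polynomial.X ^ 6 + 528 * Polynomial.X ^ 5 + 319 * Polynomial.X ^ 4
      + 136 * Polynomial.X ^ 3 + 40 * Polynomial.X ^ 2 + 8 * Polynomial.X + 1 := by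
    unfold fourNumerator
    ring
  ext n
  rw [coeff_mul_one_sub_X_sq_pow_eight, Polynomial.coeff_coe]
  simp only [coeff_mk]
  rcases lt_or_ge n 17 with hn | hn
  · rw [hN]
    simp only [Polynomial.coeff_add, Polynomial.coeff_ofNat_mul, Polynomial.coeff_X_pow,
      Polynomial.coeff_X, Polynomial.coeff_one]
    interval_cases n <;> norm_num [fourQuasipolynomial]
  · rw [Polynomial.coeff_eq_zero_of_natDegree_lt (natDegree_fourNumerator_le.trans_lt hn)]
    obtain ⟨m, rfl⟩ : ∃ m, n = m + 16 := ⟨n - 16, by omega⟩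
    -- the eighth difference with step two annihilates both constituents
    have h : ∀ j, j ≤ 16 → Even j → (if j ≤ m + 16 then fourQuasipolynomial (m + 16 - j) else 0) =
        fourQuasipolynomial (m + (16 - j)) := fun j hj _ => by
      rw [if_pos (by omega), Nat.add_sub_assoc hj]
    rw [h 2 (by norm_num) (by decide), h 4 (by norm_num) (by decide), h 6 (by norm_num) (by decide),
      h 8 (by norm_num) (by decide), h 10 (by norm_num) (by decide),
      h 12 (by norm_num) (by decide), h 14 (by norm_num) (by decide),
      h 16 (by norm_num) (by decide)]
    have hd : ∀ j, Even j → (2 ∣ m + j ↔ 2 ∣ m) := fun j hj => by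
      have := hj.two_dvd
      omega
    simp only [fourQuasipolynomial, hd _ (show Even 16 by decide),
      hd _ (show Even (16 - 2) by decide), hd _ (show Even (16 - 4) by decide),
      hd _ (show Even (16 - 6) by decide), hd _ (show Even (16 - 8) by decide),
      hd _ (show Even (16 - 10) by decide), hd _ (show Even (16 - 12) by decide),
      hd _ (show Even (16 - 14) by decide), hd _ (show Even (16 - 16) by decide)]
    split_ifs <;> push_cast <;> ring

theorem magicCount_four_eq_of_lt {s : ℕ} (hs : s < 17) :
    (magicCount 4 s : ℚ) = fourQuasipolynomial s := by
  have h : magicCount 4 s = ((List.range 17).map (magicCount 4)).getD s 0 := by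
    simp [List.getD, hs]
  rw [h, magicCount_four_values]
  interval_cases s <;> norm_num [fourQuasipolynomial]

open PowerSeries in
/-- Both generating functions, multiplied by `(1 - X ^ 2) ^ 8`, become polynomials of degree at
most `16`, so that they agree as soon as their first `17` coefficients do. -/
theorem mk_magicCount_four : (PowerSeries.mk fun s => (magicCount 4 s : ℚ)) =
    PowerSeries.mk fourQuasipolynomial := by
  have hF : (PowerSeries.mk fun s => (magicCount 4 s : ℚ)) ∈ boundedPole 8 := by
    have := faceSeries_mem_boundedPole (by norm_num) exists_dominated_generator 8 ∅
      (finrank_faceSpan_four ∅)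
    simpa [faceSeries, magicFace, magicCount] using this
  obtain ⟨p, hp, hF⟩ := mem_boundedPole.mp hF
  have hD : ((PowerSeries.mk fun s => (magicCount 4 s : ℚ)) - PowerSeries.mk fourQuasipolynomial) *
      (1 - X ^ 2) ^ 8 = ((p - fourNumerator : Polynomial ℚ) : PowerSeries ℚ) := by
    rw [sub_mul, hF, mk_fourQuasipolynomial_mul, Polynomial.coe_sub]
  have h0 : p - fourNumerator = 0 := by
    ext n
    rcases lt_or_ge n 17 with hn | hn
    · rw [← Polynomial.coeff_coe, ← hD]
      refine (PowerSeries.X_pow_dvd_iff.mp (Dvd.dvd.mul_right ?_ _)) n hn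
      refine PowerSeries.X_pow_dvd_iff.mpr fun m hm => ?_
      rw [map_sub, coeff_mk, coeff_mk, magicCount_four_eq_of_lt hm, sub_self]
    · rw [Polynomial.coeff_sub, Polynomial.coeff_eq_zero_of_natDegree_lt (by omega),
        Polynomial.coeff_eq_zero_of_natDegree_lt (natDegree_fourNumerator_le.trans_lt hn)]
      simp
  rw [h0, Polynomial.coe_zero, mul_eq_zero] at hD
  refine sub_eq_zero.mp (hD.resolve_right (pow_ne_zero _ fun h => ?_))
  simpa using congrArg constantCoeff h

theorem magicCount_four_eq_fourQuasipolynomial (s : ℕ) :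
    (magicCount 4 s : ℚ) = fourQuasipolynomial s := by
  simpa using congrArg (PowerSeries.coeff s) mk_magicCount_four

open PowerSeries in
theorem mk_magicCount_four_eq_mul_inv : (PowerSeries.mk fun s => (magicCount 4 s : ℚ)) =
    (X ^ 8 + 4 * X ^ 7 + 18 * X ^ 6 + 36 * X ^ 5 + 50 * X ^ 4 + 36 * X ^ 3 + 18 * X ^ 2
      + 4 * X + 1 : PowerSeries ℚ) * ((1 - X) ^ 4 * (1 - X ^ 2) ^ 4)⁻¹ := by
  rw [PowerSeries.eq_mul_inv_iff_mul_eq (by simp), mk_magicCount_four]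
  have h : PowerSeries.mk fourQuasipolynomial * (1 - X ^ 2) ^ 8 = (X ^ 8 + 4 * X ^ 7 + 18 * X ^ 6
      + 36 * X ^ 5 + 50 * X ^ 4 + 36 * X ^ 3 + 18 * X ^ 2 + 4 * X + 1) * (1 + X) ^ 4 := by
    rw [mk_fourQuasipolynomial_mul, fourNumerator, ← Polynomial.coeToPowerSeries.ringHom_apply]
    simp only [map_mul, map_add, map_pow, map_one, map_ofNat,
      Polynomial.coeToPowerSeries.ringHom_apply, Polynomial.coe_X]
  have h1 : (1 + X : PowerSeries ℚ) ^ 4 ≠ 0 := pow_ne_zero _ fun h => by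
    simpa using congrArg constantCoeff h
  refine mul_right_cancel₀ h1 ?_
  rw [← h]
  ring

/-! ### The period and the degree of the quasipolynomial -/

open Polynomial in
/-- The constituents of the quasipolynomial that counts `4 × 4` magic squares. -/
noncomputable def fourConstituent : Fin 2 → ℂ[X] :=
  ![C (1 / 480) * X ^ 7 + C (7 / 240) * X ^ 6 + C (89 / 480) * X ^ 5 + C (11 / 16) * X ^ 4
      + C (49 / 30) * X ^ 3 + C (38 / 15) * X ^ 2 + C (71 / 30) * X + C 1,
    C (1 / 480) * X ^ 7 + C (7 / 240) * X ^ 6 + C (89 / 480) * X ^ 5 + C (11 / 16) * X ^ 4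
      + C (779 / 480) * X ^ 3 + C (593 / 240) * X ^ 2 + C (1051 / 480) * X + C (13 / 16)]

theorem hasConstituents_four :
    HasConstituents (fun s => (magicCount 4 s : ℂ)) 2 fourConstituent := by
  refine ⟨two_pos, fun m i hm => ?_⟩
  have h : (magicCount 4 m : ℂ) = ((fourQuasipolynomial m : ℚ) : ℂ) := by
    rw [← magicCount_four_eq_fourQuasipolynomial, Rat.cast_natCast]
  refine h.trans ?_
  rw [fourQuasipolynomial]
  fin_cases i
  · rw [if_pos ((Nat.modEq_zero_iff_dvd).mp hm)]
    simp [fourConstituent]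
  · rw [if_neg fun h => absurd (hm.symm.trans ((Nat.modEq_zero_iff_dvd).mpr h)) (by decide)]
    simp [fourConstituent]

theorem isQuasipolynomialOfPeriod_four :
    IsQuasipolynomialOfPeriod (fun s => (magicCount 4 s : ℂ)) 2 := by
  refine ⟨⟨_, hasConstituents_four⟩, fun N hN => ?_⟩
  obtain ⟨p, hpos, hp⟩ := hN
  by_contra hlt
  obtain rfl : N = 1 := by omega
  -- a single polynomial would equal each of the two constituents
  have key : ∀ i : Fin 2, p 0 = fourConstituent i := fun i => by
    refine Polynomial.eq_of_infinite_eval_eq _ _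
      ((Set.infinite_range_of_injective (f := fun k : ℕ => ((2 * k + i : ℕ) : ℂ)) ?_).mono ?_)
    · intro a b h
      have := Nat.cast_injective h
      omega
    · rintro _ ⟨k, rfl⟩
      have h1 := hp (2 * k + i) 0 (Nat.modEq_one)
      have h2 := hasConstituents_four.2 (2 * k + i) i (by simp [Nat.ModEq])
      exact h1.symm.trans h2
  have h := congrArg (Polynomial.eval 0) ((key 0).symm.trans (key 1))
  norm_num [fourConstituent] at h

theorem isQuasipolynomialOfDegree_four :
    IsQuasipolynomialOfDegree (fun s => (magicCount 4 s : ℂ)) 7 := by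
  refine ⟨2, fourConstituent, hasConstituents_four, ?_⟩
  have h0 : (fourConstituent 0).degree = 7 := by
    simp only [fourConstituent, Matrix.cons_val_zero]
    compute_degree!
  have h1 : (fourConstituent 1).degree = 7 := by
    simp only [fourConstituent, Matrix.cons_val_one, Matrix.cons_val_fin_one]
    compute_degree!
  rw [show (Finset.univ : Finset (Fin 2)) = {0, 1} from rfl, Finset.sup_insert,
    Finset.sup_singleton, h0, h1, sup_idem]
  rfl

/-! ### Linear functionals on the polytope of stochastic magic squares -/

theorem isCompact_stochasticMagicPolytope (n : ℕ) : IsCompact (stochasticMagicPolytope n) := by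
  have hK : IsCompact (Set.univ.pi fun _ : Fin n => Set.univ.pi fun _ : Fin n =>
      Set.Icc (0 : ℝ) 1) := isCompact_univ_pi fun _ => isCompact_univ_pi fun _ => isCompact_Icc
  refine hK.of_isClosed_subset ?_ ?_
  · have he : ∀ i j, Continuous fun A : Fin n → Fin n → ℝ => A i j := fun i j => by fun_prop
    have hs : ∀ f g : Fin n → Fin n, IsClosed {A : Fin n → Fin n → ℝ | ∑ k, A (f k) (g k) = 1} :=
      fun f g => isClosed_eq (continuous_finsetSum _ fun k _ => he _ _) continuous_const
    have : stochasticMagicPolytope n = (⋂ i, ⋂ j, {A | 0 ≤ A i j}) ∩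
        ((⋂ i, {A | ∑ k, A i k = 1}) ∩ ((⋂ j, {A | ∑ k, A k j = 1}) ∩
          ({A | ∑ k, A k k = 1} ∩ {A | ∑ k, A k k.rev = 1}))) := by
      ext A
      simp [stochasticMagicPolytope, HasMagicSum]
    rw [this]
    exact (isClosed_iInter fun i => isClosed_iInter fun j =>
      isClosed_le continuous_const (he i j)).inter
        ((isClosed_iInter fun i => hs (fun _ => i) id).inter
          ((isClosed_iInter fun j => hs id fun _ => j).inter
            ((hs id id).inter (hs id Fin.rev))))
  · intro A hA i _ j _
    exact ⟨hA.1 i j, (hA.2.1 i) ▸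
      Finset.single_le_sum (f := fun j => A i j) (fun j _ => hA.1 i j) (Finset.mem_univ j)⟩

theorem convex_stochasticMagicPolytope (n : ℕ) : Convex ℝ (stochasticMagicPolytope n) := by
  rintro A ⟨hA, hA1, hA2, hA3, hA4⟩ B ⟨hB, hB1, hB2, hB3, hB4⟩ a b ha hb hab
  refine ⟨fun i j => ?_, fun i => ?_, fun j => ?_, ?_, ?_⟩
  · exact add_nonneg (mul_nonneg ha (hA i j)) (mul_nonneg hb (hB i j))
  · simp [Finset.sum_add_distrib, ← Finset.mul_sum, hA1, hB1, hab]
  · simp [Finset.sum_add_distrib, ← Finset.mul_sum, hA2, hB2, hab]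
  · simp [Finset.sum_add_distrib, ← Finset.mul_sum, hA3, hB3, hab]
  · simp [Finset.sum_add_distrib, ← Finset.mul_sum, hA4, hB4, hab]

/-- If the polytope is integral then its vertices are magic squares of magic sum `1`, so by the
Krein–Milman theorem an upper bound for a linear functional on these squares holds on the whole
polytope. -/
theorem le_of_isIntegralPolytope {n : ℕ} (h : IsIntegralPolytope (stochasticMagicPolytope n))
    (F : (Fin n → Fin n → ℝ) →ₗ[ℝ] ℝ) (c : ℝ)
    (hF : ∀ B ∈ magicSquares n 1, F (fun i j => (B i j : ℝ)) ≤ c) :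
    ∀ A ∈ stochasticMagicPolytope n, F A ≤ c := by
  have hKM := closure_convexHull_extremePoints (E := Fin n → Fin n → ℝ)
    (isCompact_stochasticMagicPolytope n) (convex_stochasticMagicPolytope n)
  intro A hA
  have hA' : A ∈ closure (convexHull ℝ (Set.extremePoints ℝ
      (E := Fin n → Fin n → ℝ) (stochasticMagicPolytope n))) := hKM.symm ▸ hA
  have hsub : closure (convexHull ℝ (Set.extremePoints ℝ
      (E := Fin n → Fin n → ℝ) (stochasticMagicPolytope n))) ⊆ {A | F A ≤ c} := by
    refine closure_minimal (convexHull_min ?_ (convex_halfSpace_le F.isLinear c))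
      (isClosed_le (LinearMap.continuous_of_finiteDimensional F) continuous_const)
    intro V hV
    have hVP : V ∈ stochasticMagicPolytope n := hV.1
    have hint : ∀ i j, ∃ b : ℕ, V i j = b := fun i j => by
      obtain ⟨z, hz⟩ := h V hV i j
      have h0 : (0 : ℝ) ≤ z := hz ▸ hVP.1 i j
      lift z to ℕ using by exact_mod_cast h0
      exact ⟨z, by simpa using hz⟩
    choose B hB using hint
    obtain rfl : V = fun i j => (B i j : ℝ) := funext fun i => funext fun j => hB i j
    refine hF B ?_
    obtain ⟨-, h1, h2, h3, h4⟩ := hVP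
    beta_reduce at h1 h2 h3 h4
    exact ⟨fun i => by exact_mod_cast h1 i, fun j => by exact_mod_cast h2 j,
      by exact_mod_cast h3, by exact_mod_cast h4⟩
  exact hsub hA'

/-! ### Convex combinations of permutation matrices -/

/-- The combination with weights `c k` of the permutation matrices of the `σ k`. -/
def permCombination {n m : ℕ} (c : Fin m → ℝ) (σ : Fin m → Equiv.Perm (Fin n)) :
    Fin n → Fin n → ℝ :=
  fun i j => ∑ k, if σ k i = j then c k else 0

/-- The conditions on the diagonals are that the average numbers of fixed points of the `σ k` and
of their coincidences with the reversal are `1`. -/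
theorem permCombination_mem {n m : ℕ} {c : Fin m → ℝ} {σ : Fin m → Equiv.Perm (Fin n)}
    (h0 : ∀ k, 0 ≤ c k) (h1 : ∑ k, c k = 1)
    (hd : ∑ k, c k * (Finset.univ.filter fun i => σ k i = i).card = 1)
    (ha : ∑ k, c k * (Finset.univ.filter fun i => σ k i = i.rev).card = 1) :
    permCombination c σ ∈ stochasticMagicPolytope n := by
  have key : ∀ f : Fin n → Fin n, ∑ i, permCombination c σ i (f i) =
      ∑ k, c k * (Finset.univ.filter fun i => σ k i = f i).card := fun f => by
    simp only [permCombination]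
    rw [Finset.sum_comm]
    refine Finset.sum_congr rfl fun k _ => ?_
    rw [← Finset.sum_filter, Finset.sum_const, nsmul_eq_mul, mul_comm]
  refine ⟨fun i j => Finset.sum_nonneg fun k _ => ?_, fun i => ?_, fun j => ?_, ?_, ?_⟩
  · split_ifs
    exacts [h0 k, le_rfl]
  · simp only [permCombination]
    rw [Finset.sum_comm]
    simpa using h1
  · simp only [permCombination]
    rw [Finset.sum_comm]
    simp only [← Equiv.eq_symm_apply]
    simpa using h1
  · exact (key id).trans hd
  · exact (key Fin.rev).trans ha

/-- The cyclic shift `i ↦ i + 1` modulo `n`. -/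
def cyclicShift (n : ℕ) : Equiv.Perm (Fin n) where
  toFun i := ⟨if (i : ℕ) + 1 = n then 0 else i + 1, by split_ifs <;> omega⟩
  invFun i := ⟨if (i : ℕ) = 0 then n - 1 else i - 1, by split_ifs <;> omega⟩
  left_inv i := by
    ext
    by_cases h : (i : ℕ) + 1 = n
    · simp only [if_pos h, if_true]
      omega
    · simp [h]
  right_inv i := by
    ext
    have := i.isLt
    by_cases h : (i : ℕ) = 0
    · simp only [if_pos h]
      rw [if_pos (by omega), h]
    · simp only [if_neg h]
      rw [if_neg (by omega)]
      omega

theorem val_cyclicShift {n : ℕ} (i : Fin n) :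
    (cyclicShift n i : ℕ) = if (i : ℕ) + 1 = n then 0 else (i : ℕ) + 1 :=
  rfl

theorem val_cyclicShift_symm {n : ℕ} (i : Fin n) :
    ((cyclicShift n).symm i : ℕ) = if (i : ℕ) = 0 then n - 1 else (i : ℕ) - 1 :=
  rfl

/-! ### Non-integrality for even `n` -/

/-- The sum of the entries in the cells `(i, j)` with `i + j` odd. -/
def oddCellSum {R : Type*} [AddCommMonoid R] {n : ℕ} (A : Fin n → Fin n → R) : R :=
  ∑ i : Fin n, ∑ j : Fin n, if ((i : ℕ) + (j : ℕ)) % 2 = 1 then A i j else 0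

/-- For even `n`, a magic square of magic sum `1` has an even number of units in cells `(i, j)`
with `i + j` odd, and one of them is on the antidiagonal. -/
theorem two_le_oddCellSum {n : ℕ} (hn : Even n) {B : Matrix (Fin n) (Fin n) ℕ}
    (hB : B ∈ magicSquares n 1) : 2 ≤ oddCellSum B := by
  obtain ⟨h1, h2, -, h4⟩ := hB
  have hr : ∑ i : Fin n, ∑ j : Fin n, (if (i : ℕ) % 2 = 0 then B i j else 0) =
      ∑ i : Fin n, if (i : ℕ) % 2 = 0 then 1 else 0 := by
    refine Finset.sum_congr rfl fun i _ => ?_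
    split_ifs
    exacts [h1 i, Finset.sum_const_zero]
  have hc : ∑ i : Fin n, ∑ j : Fin n, (if (j : ℕ) % 2 = 0 then B i j else 0) =
      ∑ i : Fin n, if (i : ℕ) % 2 = 0 then 1 else 0 := by
    rw [Finset.sum_comm]
    refine Finset.sum_congr rfl fun j _ => ?_
    split_ifs
    exacts [h2 j, Finset.sum_const_zero]
  -- the odd cells in even columns carry as much as the odd cells in even rows
  have hs : oddCellSum B + ∑ i : Fin n, ∑ j : Fin n, (if (i : ℕ) % 2 = 0 then B i j else 0) =
      ∑ i : Fin n, ∑ j : Fin n, (if (j : ℕ) % 2 = 0 then B i j else 0) +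
        2 * ∑ i : Fin n, ∑ j : Fin n, (if (i : ℕ) % 2 = 0 ∧
          (j : ℕ) % 2 = 1 then B i j else 0) := by
    simp only [oddCellSum, Finset.mul_sum, ← Finset.sum_add_distrib]
    refine Finset.sum_congr rfl fun i _ => Finset.sum_congr rfl fun j _ => ?_
    split_ifs <;> omega
  have hle : 1 ≤ oddCellSum B := by
    rw [← h4]
    refine Finset.sum_le_sum fun i _ => ?_
    have hi : ((i : ℕ) + i.rev) % 2 = 1 := by
      obtain ⟨m, rfl⟩ := hn
      rw [Fin.val_rev]
      omega
    refine le_trans (le_of_eq (if_pos hi).symm) (Finset.single_le_sum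
      (f := fun j : Fin n => if ((i : ℕ) + j) % 2 = 1 then B i j else 0) (fun _ _ => Nat.zero_le _)
      (Finset.mem_univ i.rev))
  rw [hr, hc] at hs
  omega

/-- The combination of the identity, the reversal and the shift by two with weights `1 / n`, `1 / n`
and `1 - 2 / n` has only the cells of the reversal in its odd part, which therefore has sum `1`. -/
theorem not_isIntegralPolytope_of_even {n : ℕ} (h2 : 2 < n) (hn : Even n) :
    ¬ IsIntegralPolytope (stochasticMagicPolytope n) := by
  intro h
  have hnR : (2 : ℝ) < n := by exact_mod_cast h2
  have hodd : ∀ a : Fin n, (a : ℕ) % 2 ≠ (a.rev : ℕ) % 2 := fun a => by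
    obtain ⟨m, rfl⟩ := hn
    rw [Fin.val_rev]
    omega
  have hshift : ∀ a : Fin n, (cyclicShift n (cyclicShift n a) : ℕ) % 2 = (a : ℕ) % 2 := fun a => by
    obtain ⟨m, rfl⟩ := hn
    simp only [val_cyclicShift]
    split_ifs <;> omega
  let σ : Fin 3 → Equiv.Perm (Fin n) := ![1, Fin.revPerm, (cyclicShift n).trans (cyclicShift n)]
  let c : Fin 3 → ℝ := ![1 / n, 1 / n, 1 - 2 / n]
  have hcard : ∀ p : Fin n → Prop, ∀ _ : DecidablePred p, (∀ a, ¬ p a) →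
      (Finset.univ.filter p).card = 0 := fun p _ hp => by
    simp [Finset.filter_false_of_mem fun a _ => hp a]
  have hmem : permCombination c σ ∈ stochasticMagicPolytope n := by
    refine permCombination_mem (fun k => ?_) ?_ ?_ ?_
    · fin_cases k
      · simp [c]
      · simp [c]
      · simp only [c]
        have : (2 : ℝ) / n ≤ 1 := by rw [div_le_one] <;> linarith
        simpa using this
    · simp [c, Fin.sum_univ_three]
      ring
    · rw [Fin.sum_univ_three, hcard (fun a => σ 1 a = a), hcard (fun a => σ 2 a = a)]
      · simp [c, σ]
        field_simp
      · intro a ha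
        have := congrArg Fin.val ha
        simp only [σ, Matrix.cons_val, Equiv.trans_apply, val_cyclicShift] at this
        split_ifs at this <;> omega
      · intro a ha
        exact hodd a (by rw [show a.rev = a from ha])
    · rw [Fin.sum_univ_three, hcard (fun a => σ 0 a = a.rev), hcard (fun a => σ 2 a = a.rev)]
      · simp [c, σ]
        field_simp
      · intro a ha
        have := hshift a
        rw [show cyclicShift n (cyclicShift n a) = a.rev from ha] at this
        exact hodd a this.symm
      · intro a ha
        exact hodd a (by rw [← show a = a.rev from ha])
  let F : (Fin n → Fin n → ℝ) →ₗ[ℝ] ℝ :=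
    { toFun := fun A => - oddCellSum A
      map_add' := fun A B => by
        simp only [oddCellSum, Pi.add_apply, ← Finset.sum_neg_distrib, ← Finset.sum_add_distrib]
        refine Finset.sum_congr rfl fun i _ => Finset.sum_congr rfl fun j _ => ?_
        split_ifs <;> ring
      map_smul' := fun a A => by
        simp only [oddCellSum, Pi.smul_apply, smul_eq_mul, RingHom.id_apply, Finset.mul_sum,
          ← Finset.sum_neg_distrib]
        refine Finset.sum_congr rfl fun i _ => Finset.sum_congr rfl fun j _ => ?_
        split_ifs <;> ring }
  have hle : - oddCellSum (permCombination c σ) ≤ -2 := by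
    refine le_of_isIntegralPolytope h F (-2) (fun B hB => ?_) _ hmem
    have : oddCellSum (fun i j => (B i j : ℝ)) = (oddCellSum B : ℕ) := by
      simp [oddCellSum]
    change - oddCellSum (fun i j => (B i j : ℝ)) ≤ -2
    rw [this, neg_le_neg_iff]
    exact_mod_cast two_le_oddCellSum hn hB
  have hval : oddCellSum (permCombination c σ) = 1 := by
    have hrow : ∀ i : Fin n, (∑ j : Fin n,
        if ((i : ℕ) + j) % 2 = 1 then permCombination c σ i j else 0) = 1 / n := fun i => by
      have h0 := hodd i
      have h1 := hshift i
      simp only [permCombination, Fin.sum_univ_three]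
      have : ∀ j : Fin n, (if ((i : ℕ) + j) % 2 = 1 then
          ((if σ 0 i = j then c 0 else 0) + if σ 1 i = j then c 1 else 0) +
            if σ 2 i = j then c 2 else 0 else 0) = if i.rev = j then 1 / (n : ℝ) else 0 := by
        intro j
        have e0 : σ 0 i = i := rfl
        have e1 : σ 1 i = i.rev := rfl
        have e2 : σ 2 i = cyclicShift n (cyclicShift n i) := rfl
        rw [e0, e1, e2]
        split_ifs with g1 g2 g3 g4 g5 g6 g7 g8 g9 <;> subst_vars <;> first | omega | simp [c]
      simp only [this]
      simp
    rw [oddCellSum, Finset.sum_congr rfl fun i _ => hrow i]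
    simp
    field_simp
  rw [hval] at hle
  norm_num at hle

/-! ### Non-integrality for odd `n` -/

/-- In a magic square of magic sum `1` at most one corner is occupied, whereas the corners of a
suitable combination of two diagonals, two shifts and two shifted reversals have sum
`1 + 1 / (2 * m + 1)`. -/
theorem not_isIntegralPolytope_of_odd {m : ℕ} (hm : 0 < m) :
    ¬ IsIntegralPolytope (stochasticMagicPolytope (2 * m + 1)) := by
  intro h
  have hmR : (0 : ℝ) < m := by exact_mod_cast hm
  -- modulo `2 * m + 1`: the identity, `-1 - i`, `i + 1`, `i - 1`, `-i` and `-2 - i`. The first two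
  -- are the diagonals, which share one cell; the shifts meet the antidiagonal once and miss the
  -- diagonal, the last two meet the diagonal once and miss the antidiagonal.
  let σ : Fin 6 → Equiv.Perm (Fin (2 * m + 1)) :=
    ![1, Fin.revPerm, cyclicShift _, (cyclicShift _).symm, Fin.revPerm.trans (cyclicShift _),
      Fin.revPerm.trans (cyclicShift _).symm]
  let c : Fin 6 → ℝ := ![1 / (2 * (2 * m + 1)), 1 / (2 * (2 * m + 1)), m / (2 * (2 * m + 1)),
    m / (2 * (2 * m + 1)), m / (2 * (2 * m + 1)), m / (2 * (2 * m + 1))]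
  have e0 : ∀ i, σ 0 i = i := fun _ => rfl
  have e1 : ∀ i, σ 1 i = i.rev := fun _ => rfl
  have e2 : ∀ i, σ 2 i = cyclicShift _ i := fun _ => rfl
  have e3 : ∀ i, σ 3 i = (cyclicShift _).symm i := fun _ => rfl
  have e4 : ∀ i, σ 4 i = cyclicShift _ i.rev := fun _ => rfl
  have e5 : ∀ i, σ 5 i = (cyclicShift _).symm i.rev := fun _ => rfl
  have hcard1 : ∀ a : Fin (2 * m + 1), ∀ p : Fin (2 * m + 1) → Prop, ∀ _ : DecidablePred p,
      (∀ i, p i ↔ i = a) → (Finset.univ.filter p).card = 1 := fun a p _ hp => by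
    simp only [hp]
    rw [Finset.filter_eq' _ a, if_pos (Finset.mem_univ a), Finset.card_singleton]
  have hcard0 : ∀ p : Fin (2 * m + 1) → Prop, ∀ _ : DecidablePred p,
      (∀ i, ¬ p i) → (Finset.univ.filter p).card = 0 := fun p _ hp => by
    simp [Finset.filter_false_of_mem fun a _ => hp a]
  have hmem : permCombination c σ ∈ stochasticMagicPolytope (2 * m + 1) := by
    refine permCombination_mem (fun k => ?_) ?_ ?_ ?_
    · fin_cases k <;> simp [c] <;> positivity
    · simp [c, Fin.sum_univ_six]
      field_simp
      ring
    · rw [Fin.sum_univ_six, hcard1 ⟨m, by omega⟩ (fun a => σ 1 a = a),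
        hcard0 (fun a => σ 2 a = a), hcard0 (fun a => σ 3 a = a),
        hcard1 ⟨0, by omega⟩ (fun a => σ 4 a = a), hcard1 ⟨2 * m, by omega⟩ (fun a => σ 5 a = a)]
      · simp [c, σ]
        field_simp
        ring
      all_goals
        intro i
        simp only [e1, e2, e3, e4, e5, Fin.ext_iff, val_cyclicShift, val_cyclicShift_symm,
          Fin.val_rev]
        (try split_ifs) <;> omega
    · rw [Fin.sum_univ_six, hcard1 ⟨m, by omega⟩ (fun a => σ 0 a = a.rev),
        hcard1 ⟨2 * m, by omega⟩ (fun a => σ 2 a = a.rev),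
        hcard1 ⟨0, by omega⟩ (fun a => σ 3 a = a.rev),
        hcard0 (fun a => σ 4 a = a.rev), hcard0 (fun a => σ 5 a = a.rev)]
      · simp [c, σ]
        field_simp
        ring
      all_goals
        intro i
        simp only [e0, e2, e3, e4, e5, Fin.ext_iff, val_cyclicShift, val_cyclicShift_symm,
          Fin.val_rev]
        (try split_ifs) <;> omega
  let l : Fin (2 * m + 1) := Fin.last (2 * m)
  have hl : (l : ℕ) = 2 * m := rfl
  let F : (Fin (2 * m + 1) → Fin (2 * m + 1) → ℝ) →ₗ[ℝ] ℝ :=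
    { toFun := fun A => A 0 0 + A 0 l + A l 0 + A l l
      map_add' := fun A B => by
        simp only [Pi.add_apply]
        ring
      map_smul' := fun a A => by
        simp only [Pi.smul_apply, smul_eq_mul, RingHom.id_apply]
        ring }
  -- any two corners lie in a common row, column or diagonal
  have hle : F (permCombination c σ) ≤ 1 := by
    refine le_of_isIntegralPolytope h F 1 (fun B hB => ?_) _ hmem
    obtain ⟨h1, h2, h3, h4⟩ := hB
    have h0l : (0 : Fin (2 * m + 1)) ≠ l := fun h => by
      have := congrArg Fin.val h
      rw [hl, Fin.val_zero] at this
      omega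
    have two : ∀ f : Fin (2 * m + 1) → ℕ, f 0 + f l ≤ ∑ i, f i := fun f => by
      rw [← Finset.sum_pair h0l]
      exact Finset.sum_le_sum_of_subset (Finset.subset_univ _)
    have r0 := (two (B 0)).trans_eq (h1 0)
    have rl := (two (B l)).trans_eq (h1 l)
    have c0 := (two fun i => B i 0).trans_eq (h2 0)
    have cl := (two fun i => B i l).trans_eq (h2 l)
    have d := (two fun i => B i i).trans_eq h3
    have d' := (two fun i => B i i.rev).trans_eq h4
    have hr0 : (0 : Fin (2 * m + 1)).rev = l := Fin.rev_zero _
    have hrl : l.rev = 0 := Fin.rev_last _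
    rw [hr0, hrl] at d'
    have : B 0 0 + B 0 l + B l 0 + B l l ≤ 1 := by omega
    change ((B 0 0 : ℝ) + B 0 l + B l 0 + B l l) ≤ 1
    exact_mod_cast this
  have hval : F (permCombination c σ) = 1 + 1 / (2 * m + 1) := by
    change permCombination c σ 0 0 + permCombination c σ 0 l + permCombination c σ l 0 +
      permCombination c σ l l = _
    simp only [permCombination, Fin.sum_univ_six, e0, e1, e2, e3, e4, e5, Fin.ext_iff,
      val_cyclicShift, val_cyclicShift_symm, Fin.val_rev, hl, Fin.val_zero]
    have t1 : ¬ (2 * m = 0) := by omega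
    have t2 : ¬ (0 = 2 * m) := by omega
    have t3 : ¬ (2 * m - 1 = 2 * m) := by omega
    have t4 : ¬ (2 * m - 1 = 0) := by omega
    have t5 : ¬ (1 = 2 * m) := by omega
    simp [t1, t2, t3, t4, t5, c]
    field_simp
    ring
  rw [hval] at hle
  have : (0 : ℝ) < 1 / (2 * m + 1) := by positivity
  linarith

theorem not_isIntegralPolytope {n : ℕ} (hn : 2 < n) :
    ¬ IsIntegralPolytope (stochasticMagicPolytope n) := by
  rcases Nat.even_or_odd n with he | ⟨m, rfl⟩
  · exact not_isIntegralPolytope_of_even hn he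
  · exact not_isIntegralPolytope_of_odd (by omega)

/-! ### The theorem on magic squares of order four and five and on integrality -/

open PowerSeries in
theorem theorem0p3 :
    -- the generating function of the number of 4 × 4 magic squares, and its first coefficients
    (PowerSeries.mk fun s => (magicCount 4 s : ℚ)) =
        (X ^ 8 + 4 * X ^ 7 + 18 * X ^ 6 + 36 * X ^ 5 + 50 * X ^ 4 + 36 * X ^ 3 + 18 * X ^ 2
          + 4 * X + 1 : PowerSeries ℚ) * ((1 - X) ^ 4 * (1 - X ^ 2) ^ 4)⁻¹ ∧
    (List.range 9).map (magicCount 4) = [1, 8, 48, 200, 675, 1904, 4736, 10608, 21925] ∧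
    -- the explicit formula
    (∀ s : ℕ, (magicCount 4 s : ℚ) =
      if 2 ∣ s then
        1 / 480 * (s : ℚ) ^ 7 + 7 / 240 * (s : ℚ) ^ 6 + 89 / 480 * (s : ℚ) ^ 5
          + 11 / 16 * (s : ℚ) ^ 4 + 49 / 30 * (s : ℚ) ^ 3 + 38 / 15 * (s : ℚ) ^ 2
          + 71 / 30 * (s : ℚ) + 1
      else
        1 / 480 * (s : ℚ) ^ 7 + 7 / 240 * (s : ℚ) ^ 6 + 89 / 480 * (s : ℚ) ^ 5
          + 11 / 16 * (s : ℚ) ^ 4 + 779 / 480 * (s : ℚ) ^ 3 + 593 / 240 * (s : ℚ) ^ 2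
          + 1051 / 480 * (s : ℚ) + 13 / 16) ∧
    IsQuasipolynomialOfPeriod (fun s => (magicCount 4 s : ℂ)) 2 ∧
    IsQuasipolynomialOfDegree (fun s => (magicCount 4 s : ℂ)) 7 ∧
    -- the number of 5 × 5 magic squares of magic sum at most 6
    (List.range 7).map (magicCount 5) = [1, 20, 449, 6792, 67063, 484419, 2750715] ∧
    -- non-integrality of the polytope of stochastic magic squares
    (∀ n : ℕ, 2 < n → ¬ IsIntegralPolytope (stochasticMagicPolytope n)) := by
  refine ⟨mk_magicCount_four_eq_mul_inv, ?_, magicCount_four_eq_fourQuasipolynomial,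
    isQuasipolynomialOfPeriod_four, isQuasipolynomialOfDegree_four, magicCount_five_values,
    fun n hn => not_isIntegralPolytope hn⟩
  have h := congrArg (List.take 9) magicCount_four_values
  rwa [← List.map_take, List.take_range] at h
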